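/- Let $(\mathcal H^3,h)$ be hyperbolic 3-space with a fixed orientation, let $\mathcal V\subset\mathcal H^3$ be open, and let $V:\mathcal V\to(0,\infty)$ be a positive harmonic function. Let $\pi:\mathcal M\to\mathcal V$ be a principal circle bundle with a real-valued connection 1-form $\theta$ (normalized so that $\theta(\xi)=1$ for the generator $\xi=\frac{d}{dt}\big|_{t=0}e^{it}\cdot{}$ of the circle action) whose curvature is $\star dV$, i.e. $d\theta=\pi^*(\star dV)$. Pull-backs by $\pi$ are suppressed from the notation below. (a) For every smooth function $f:\mathcal V\to\mathbb R$, the Ricci curvature of the metric $g=e^{2f}\left(Vh+V^{-1}\theta^2\right)$ on $\mathcal M$ is $$\begin{aligned}\mathrm{Ric}_g ={}& \left(-2-\triangle f-2|df|^2-V^{-1}\langle dV,df\rangle\right)h -2\,D df+2(df)^2+2V^{-1}\,dV\odot df\\ &+\left(-\triangle f-2|df|^2+V^{-1}\langle dV,df\rangle\right)(V^{-1}\theta)^2 -2V^{-1}\star(dV\wedge df)\odot V^{-1}\theta .\end{aligned}$$ Here $D$, $\triangle$ and $\star$ are respectively the Levi-Civita connection, the negative Laplace–Beltrami operator ($\triangle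 f=\mathrm{tr}_h\,D df$) and the Hodge star operator of $(\mathcal H^3,h)$, $|\cdot|$ and $\langle\cdot,\cdot\rangle$ are the corresponding norm and inner product on 1-forms, and $\alpha\odot\beta=\tfrac12(\alpha\otimes\beta+\beta\otimes\alpha)$, $\alpha^2=\alpha\odot\alpha$, $\alpha\wedge\beta=\alpha\otimes\beta-\beta\otimes\alpha$. (b) In particular, the metric $g=Vh+V^{-1}\theta^2$ has $\mathrm{Ric}_g=-2h$, independently of $V$. -/

import Mathlib

open scoped Manifold ContDiff EuclideanSpace

noncomputable section

namespace HypAnsatz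

/-- Euclidean `n`-space, used as coordinate space. -/
abbrev E (n : ℕ) : Type := EuclideanSpace ℝ (Fin n)

/-! ### Riemannian geometry in coordinates

A metric on (an open subset of) `E n` is given as a field of bilinear forms
`G : E n → E n → E n → ℝ`, `G p u v` being the value at the point `p` on the vectors `u`, `v`. -/

/-- The `i`-th coordinate vector. -/
def basisVec {n : ℕ} (i : Fin n) : E n := EuclideanSpace.single i 1

/-- The `i`-th partial derivative. -/
def pd {n : ℕ} (i : Fin n) (F : E n → ℝ) (p : E n) : ℝ := fderiv ℝ F p (basisVec i)

/-- The matrix `(g_{ij})` of a metric. -/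
def gram {n : ℕ} (G : E n → E n → E n → ℝ) (p : E n) : Matrix (Fin n) (Fin n) ℝ :=
  Matrix.of fun i j => G p (basisVec i) (basisVec j)

/-- The inverse matrix `(g^{ij})`. -/
def gramInv {n : ℕ} (G : E n → E n → E n → ℝ) (p : E n) : Matrix (Fin n) (Fin n) ℝ :=
  (gram G p)⁻¹

/-- The Christoffel symbols `Γ^k_{ij}` of the Levi-Civita connection. -/
def christoffel {n : ℕ} (G : E n → E n → E n → ℝ) (k i j : Fin n) (p : E n) : ℝ :=
  (1 / 2) * ∑ l, gramInv G p k l *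
    (pd i (fun q => gram G q j l) p + pd j (fun q => gram G q i l) p
      - pd l (fun q => gram G q i j) p)

/-- The components `R_{ij}` of the Ricci tensor (positive on round spheres). -/
def ricciComp {n : ℕ} (G : E n → E n → E n → ℝ) (i j : Fin n) (p : E n) : ℝ :=
  ∑ k, (pd k (christoffel G k i j) p - pd j (christoffel G k i k) p)
    + ∑ k, ∑ l, (christoffel G k k l p * christoffel G l i j p
      - christoffel G k j l p * christoffel G l i k p)

/-- The Ricci tensor of a metric in coordinates. -/
def ricciCoord {n : ℕ} (G : E n → E n → E n → ℝ) (p u v : E n) : ℝ :=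
  ∑ i, ∑ j, u i * v j * ricciComp G i j p

/-- The Hessian `D df`, where `D` is the Levi-Civita connection of `G`. -/
def hessian {n : ℕ} (G : E n → E n → E n → ℝ) (f : E n → ℝ) (p u v : E n) : ℝ :=
  ∑ i, ∑ j, u i * v j * (pd i (pd j f) p - ∑ k, christoffel G k i j p * pd k f p)

/-- The (negative) Laplace-Beltrami operator, the trace of the Hessian. -/
def laplacian {n : ℕ} (G : E n → E n → E n → ℝ) (f : E n → ℝ) (p : E n) : ℝ :=
  ∑ i, ∑ j, gramInv G p i j * hessian G f p (basisVec i) (basisVec j)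

/-- The inner product of two covectors at `p`. -/
def cometric {n : ℕ} (G : E n → E n → E n → ℝ) (p : E n) (α β : E n → ℝ) : ℝ :=
  ∑ i, ∑ j, gramInv G p i j * α (basisVec i) * β (basisVec j)

/-- The vector metrically dual to a covector at `p`. -/
def sharp {n : ℕ} (G : E n → E n → E n → ℝ) (p : E n) (α : E n → ℝ) : E n :=
  ∑ i, (∑ j, gramInv G p i j * α (basisVec j)) • basisVec i

/-- The Riemannian volume form of a metric on `E 3` with respect to an orientation. -/
def volForm (o : Orientation ℝ (E 3) (Fin 3)) (G : E 3 → E 3 → E 3 → ℝ) (p u v w : E 3) : ℝ :=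
  Real.sqrt (gram G p).det * o.volumeForm ![u, v, w]

/-- The Hodge star of a covector in dimension three, `(⋆α)(u, v) = vol(α♯, u, v)`. -/
def starOne (o : Orientation ℝ (E 3) (Fin 3)) (G : E 3 → E 3 → E 3 → ℝ) (p : E 3)
    (α : E 3 → ℝ) (u v : E 3) : ℝ :=
  volForm o G p (sharp G p α) u v

/-- The Hodge star of an alternating `2`-form in dimension three,
`(⋆β)(u) = (1/2) g^{ik} g^{jl} β_{ij} vol(e_k, e_l, u)`. -/
def starTwo (o : Orientation ℝ (E 3) (Fin 3)) (G : E 3 → E 3 → E 3 → ℝ) (p : E 3)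
    (β : E 3 → E 3 → ℝ) (u : E 3) : ℝ :=
  (1 / 2) * ∑ i, ∑ j, ∑ k, ∑ l, gramInv G p i k * gramInv G p j l *
    β (basisVec i) (basisVec j) * volForm o G p (basisVec k) (basisVec l) u

/-- The wedge product of two covectors. -/
def wedge {W : Type*} (α β : W → ℝ) (u v : W) : ℝ := α u * β v - α v * β u

/-- The symmetric product of two covectors, so that `α ⊙ α = α ⊗ α = α²`. -/
def symProd {W : Type*} (α β : W → ℝ) (u v : W) : ℝ := (1 / 2) * (α u * β v + α v * β u)

/-! ### Hyperbolic 3-space: the upper half-space model -/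

/-- The upper half-space `z > 0`. -/
def upperHalfSpace : Set (E 3) := {p | 0 < p 2}

/-- The hyperbolic metric `(dx² + dy² + dz²) / z²`. -/
def hyp (p u v : E 3) : ℝ := inner ℝ u v / (p 2) ^ 2

/-- Harmonic functions on an open subset of hyperbolic 3-space. -/
def IsHarmonicOn (V : E 3 → ℝ) (𝒱 : Set (E 3)) : Prop :=
  ContDiffOn ℝ 2 V 𝒱 ∧ ∀ p ∈ 𝒱, laplacian hyp V p = 0

/-! ### Tensors on manifolds -/

section Manifold

variable {n : ℕ} {M : Type*} [TopologicalSpace M] [ChartedSpace (E n) M]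

/-- The coordinate expression of a field of bilinear forms in the chart at `m`. -/
def coordForm₂ (g : (x : M) → TangentSpace (𝓡 n) x → TangentSpace (𝓡 n) x → ℝ) (m : M) :
    E n → E n → E n → ℝ :=
  fun y u v => g ((extChartAt (𝓡 n) m).symm y)
    (mfderiv (𝓡 n) (𝓡 n) (extChartAt (𝓡 n) m).symm y u)
    (mfderiv (𝓡 n) (𝓡 n) (extChartAt (𝓡 n) m).symm y v)

/-- The Ricci tensor of a metric `g` on `M`, at the point `m`, computed in the chart at `m`. -/
def ricci (g : (x : M) → TangentSpace (𝓡 n) x → TangentSpace (𝓡 n) x → ℝ) (m : M)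
    (u v : TangentSpace (𝓡 n) m) : ℝ :=
  ricciCoord (coordForm₂ g m) (extChartAt (𝓡 n) m m)
    (mfderiv (𝓡 n) (𝓡 n) (extChartAt (𝓡 n) m) m u)
    (mfderiv (𝓡 n) (𝓡 n) (extChartAt (𝓡 n) m) m v)

/-- The coordinate expression of a `1`-form in the chart at `m`. -/
def coordForm₁ (θ : (x : M) → TangentSpace (𝓡 n) x →L[ℝ] ℝ) (m : M) : E n → (E n →L[ℝ] ℝ) :=
  fun y => (θ ((extChartAt (𝓡 n) m).symm y)).comp
    (mfderiv (𝓡 n) (𝓡 n) (extChartAt (𝓡 n) m).symm y)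

/-- Smoothness of a `1`-form: its coordinate expressions are smooth. -/
def IsSmoothOneForm (θ : (x : M) → TangentSpace (𝓡 n) x →L[ℝ] ℝ) : Prop :=
  ∀ m : M, ContDiffOn ℝ ∞ (coordForm₁ θ m) (extChartAt (𝓡 n) m).target

/-- The exterior derivative of a `1`-form, at the point `m`, computed in the chart at `m`. -/
def extDerivOne (θ : (x : M) → TangentSpace (𝓡 n) x →L[ℝ] ℝ) (m : M)
    (u v : TangentSpace (𝓡 n) m) : ℝ :=
  let u' : E n := mfderiv (𝓡 n) (𝓡 n) (extChartAt (𝓡 n) m) m u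
  let v' : E n := mfderiv (𝓡 n) (𝓡 n) (extChartAt (𝓡 n) m) m v
  fderiv ℝ (coordForm₁ θ m) (extChartAt (𝓡 n) m m) u' v'
    - fderiv ℝ (coordForm₁ θ m) (extChartAt (𝓡 n) m m) v' u'

end Manifold

/-! ### Circle bundles with connection -/

section Bundle

variable {M : Type*} [TopologicalSpace M] [ChartedSpace (E 4) M]

/-- `π : M → 𝒱` is a smooth principal circle bundle over the open set `𝒱 ⊆ E 3`: the circle acts
along the fibres, and over a neighbourhood `U` of each point of `𝒱` there is an equivariant
diffeomorphism from `π⁻¹(U)` to `U × S¹` over `U`. (So the action is smooth, free, and transitive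
on the fibres.) -/
structure IsCircleBundle [MulAction Circle M] (π : M → E 3) (𝒱 : Set (E 3)) : Prop where
  smooth_proj : ContMDiff (𝓡 4) (𝓡 3) ∞ π
  proj_mem : ∀ m, π m ∈ 𝒱
  proj_smul : ∀ (z : Circle) (m : M), π (z • m) = π m
  locally_trivial : ∀ b ∈ 𝒱, ∃ U : Set (E 3), IsOpen U ∧ b ∈ U ∧ U ⊆ 𝒱 ∧
    ∃ Φ : OpenPartialHomeomorph M (E 3 × Circle),
      Φ.source = π ⁻¹' U ∧ Φ.target = U ×ˢ Set.univ ∧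
      ContMDiffOn (𝓡 4) ((𝓡 3).prod (𝓡 1)) ∞ Φ Φ.source ∧
      ContMDiffOn ((𝓡 3).prod (𝓡 1)) (𝓡 4) ∞ Φ.symm Φ.target ∧
      (∀ m ∈ Φ.source, (Φ m).1 = π m) ∧
      ∀ (z : Circle), ∀ m ∈ Φ.source, (Φ (z • m)).2 = z * (Φ m).2

/-- The generator of the circle action, `d/dt` at `t = 0` of `e^{it} • m`. -/
def generator [MulAction Circle M] (m : M) : E 4 :=
  mfderiv 𝓘(ℝ, ℝ) (𝓡 4) (fun t : ℝ => Circle.exp t • m) 0 (1 : ℝ)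

/-- The infinitesimal generator as a tangent vector at `m` (using `e^{i0} • m = m`). -/
def generatorAt [MulAction Circle M] (m : M) : TangentSpace (𝓡 4) m := generator m

/-- Connection `1`-forms on a principal circle bundle (real-valued, so that the integral of the form
over each fibre is `2π`). -/
structure IsConnectionForm [MulAction Circle M]
    (θ : (x : M) → TangentSpace (𝓡 4) x →L[ℝ] ℝ) : Prop where
  smooth : IsSmoothOneForm θ
  invariant : ∀ (z : Circle) (m : M) (v : TangentSpace (𝓡 4) m),
    θ (z • m) (mfderiv (𝓡 4) (𝓡 4) (fun x : M => z • x) m v) = θ m v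
  normalized : ∀ m : M, θ m (generatorAt m) = 1

/-- The differential of `π` as a map with values in `E 3`. -/
def dproj (π : M → E 3) (m : M) (v : TangentSpace (𝓡 4) m) : E 3 :=
  mfderiv (𝓡 4) (𝓡 3) π m v

/-- The connection `θ` has curvature `⋆dV`, that is, `dθ = π^*(⋆dV)`. -/
def HasCurvatureStarD (o : Orientation ℝ (E 3) (Fin 3)) (π : M → E 3)
    (θ : (x : M) → TangentSpace (𝓡 4) x →L[ℝ] ℝ) (V : E 3 → ℝ) : Prop :=
  ∀ (m : M) (u v : TangentSpace (𝓡 4) m),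
    extDerivOne θ m u v = starOne o hyp (π m) (fderiv ℝ V (π m)) (dproj π m u) (dproj π m v)

/-- The metric `V h + V⁻¹ θ²` on the total space. -/
def ansatz (π : M → E 3) (θ : (x : M) → TangentSpace (𝓡 4) x →L[ℝ] ℝ) (V : E 3 → ℝ)
    (m : M) (u v : TangentSpace (𝓡 4) m) : ℝ :=
  V (π m) * hyp (π m) (dproj π m u) (dproj π m v) + (V (π m))⁻¹ * (θ m u * θ m v)

/-- The metric `e^{2f} (V h + V⁻¹ θ²)` on the total space. -/
def conformalAnsatz (π : M → E 3) (θ : (x : M) → TangentSpace (𝓡 4) x →L[ℝ] ℝ)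
    (V f : E 3 → ℝ) (m : M) (u v : TangentSpace (𝓡 4) m) : ℝ :=
  Real.exp (2 * f (π m)) * ansatz π θ V m u v

end Bundle

end HypAnsatz

end

/-! The Ricci tensor is computed by Cartan's method in a moving coframe. On the total space the
pulled-back coordinate forms and the connection form give a coframe (dx, dy, dz, θ). The first three
forms are closed and dθ = ⋆dV. In this coframe g is diagonal, with base entries e^{2f}V/z² (three
times) and fibre entry e^{2f}/V, all pulled back from the base.

The Levi-Civita connection coefficients in this coframe are therefore functions on the base, built
from z, V and the first derivatives of f and V. They are recorded by `ansatzJet`. Row 0 is half the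
logarithmic derivative of the base entry, row 1 that of the fibre entry, and row 2 holds the
components of ⋆dV. Rows 3 and 4 are rows 2 and 1 multiplied by half the ratio z²/V² of the fibre
entry to the base entry. `isLeviCivitaFrame_ansatz` checks that these coefficients are metric and
torsion-free. Uniqueness of the Levi-Civita connection (`christoffel_eq`) then identifies them with
the Christoffel symbols.

Curvature in a coframe involves only the coefficients and their derivatives along the frame
(`coframe_curvature`), and the Ricci tensor is its trace (`ricciCoord_eq`). What remains is a
rational identity between 2-jets of f and V, `ricciContraction_ansatz`. In it the second derivatives
of V occur only through the Laplacian of V, so harmonicity removes them.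

To apply this in a chart of M, one needs (dπ, θ) to be injective on tangent vectors
(`eq_zero_of_dproj_eq_zero`), and dθ = π^*(⋆dV) on an open set of a single chart
(`fderiv_coordForm₁_sub`). Part (b) is the case f = 0. -/

noncomputable section

set_option maxSynthPendingDepth 3

namespace HypAnsatz

/-! ### Levi-Civita connection and curvature in a moving coframe. -/

section MovingFrame

variable {n : ℕ}

theorem sum_smul_basisVec (u : E n) : ∑ i, u i • basisVec i = u := by
  simpa [basisVec] using (EuclideanSpace.basisFun (Fin n) ℝ).sum_repr u

theorem sum_coord_smul (u : E n) (F : Fin n → E n) (k : Fin n) :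
    (∑ i, u i • F i) k = ∑ i, u i * F i k := by
  simp

/-- The connection with coefficients `C` with respect to the coframe `B`, in coordinates. -/
def frameConn (B : E n → E n →L[ℝ] E n) (C : E n → E n →L[ℝ] E n →L[ℝ] E n) (q u v : E n) : E n :=
  Ring.inverse (B q) (fderiv ℝ B q u v + C q (B q u) (B q v))

/-- The curvature of a connection in terms of its coefficients `C` with respect to a coframe `B`
for which it is torsion-free. -/
def frameCurv (B : E n → E n →L[ℝ] E n) (C : E n → E n →L[ℝ] E n →L[ℝ] E n) (q a b c : E n) : E n :=
  fderiv ℝ C q (Ring.inverse (B q) a) b c - fderiv ℝ C q (Ring.inverse (B q) b) a c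
    + C q (C q b a - C q a b) c + C q a (C q b c) - C q b (C q a c)

theorem frameCurv_sum (B : E n → E n →L[ℝ] E n) (C : E n → E n →L[ℝ] E n →L[ℝ] E n)
    (q a b c : E n) (x y : Fin n → E n) :
    frameCurv B C q a (∑ i, b i • x i) (∑ j, c j • y j)
      = ∑ i, ∑ j, (b i * c j) • frameCurv B C q a (x i) (y j) := by
  let Q : E n →ₗ[ℝ] E n →ₗ[ℝ] E n := LinearMap.mk₂ ℝ (fun b c => frameCurv B C q a b c)
    (fun b b' c => by simp only [frameCurv, map_add, map_sub, add_apply, sub_apply]; abel)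
    (fun r b c => by
      simp only [frameCurv, map_smul, map_sub, smul_apply, sub_apply, smul_add, smul_sub])
    (fun b c c' => by simp only [frameCurv, map_add]; abel)
    (fun r b c => by simp only [frameCurv, map_smul, smul_add, smul_sub])
  change Q (∑ i, b i • x i) (∑ j, c j • y j) = ∑ i, ∑ j, (b i * c j) • Q (x i) (y j)
  simp only [map_sum, map_smul, LinearMap.sum_apply, LinearMap.smul_apply, Finset.smul_sum,
    smul_smul]
  rw [Finset.sum_comm]
  simp only [mul_comm]

/-- The hypotheses making `C` the Levi-Civita connection coefficients of the metric `G`, given as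
`gF` in the coframe `B`. -/
structure IsLeviCivitaFrame (U : Set (E n)) (G : E n → E n → E n → ℝ)
    (B : E n → E n →L[ℝ] E n) (gF : E n → E n →L[ℝ] E n →L[ℝ] ℝ)
    (C : E n → E n →L[ℝ] E n →L[ℝ] E n) : Prop where
  isOpen : IsOpen U
  coframe : ContDiffOn ℝ 2 B U
  isUnit : ∀ q ∈ U, IsUnit (B q)
  metric_eq : ∀ q ∈ U, ∀ u v, G q u v = gF q (B q u) (B q v)
  metric_diff : ∀ q ∈ U, DifferentiableAt ℝ gF q
  metric_symm : ∀ q ∈ U, ∀ b c, gF q b c = gF q c b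
  metric_nondeg : ∀ q ∈ U, ∀ b, (∀ c, gF q b c = 0) → b = 0
  conn_diff : ∀ q ∈ U, DifferentiableAt ℝ C q
  compat : ∀ q ∈ U, ∀ u b c, fderiv ℝ gF q u b c = gF q (C q (B q u) b) c + gF q b (C q (B q u) c)
  torsion : ∀ q ∈ U, ∀ u v, fderiv ℝ B q u v - fderiv ℝ B q v u
    = C q (B q v) (B q u) - C q (B q u) (B q v)

namespace IsLeviCivitaFrame

variable {U : Set (E n)} {G : E n → E n → E n → ℝ} {B : E n → E n →L[ℝ] E n}
  {gF : E n → E n →L[ℝ] E n →L[ℝ] ℝ} {C : E n → E n →L[ℝ] E n →L[ℝ] E n} {q : E n}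

theorem coframe_inverse (h : IsLeviCivitaFrame U G B gF C) (hq : q ∈ U) (a : E n) :
    B q (Ring.inverse (B q) a) = a := by
  have := Ring.mul_inverse_cancel _ (h.isUnit q hq)
  exact DFunLike.congr_fun this a

theorem inverse_coframe (h : IsLeviCivitaFrame U G B gF C) (hq : q ∈ U) (a : E n) :
    Ring.inverse (B q) (B q a) = a := by
  have := Ring.inverse_mul_cancel _ (h.isUnit q hq)
  exact DFunLike.congr_fun this a

theorem coframe_diff (h : IsLeviCivitaFrame U G B gF C) (hq : q ∈ U) : DifferentiableAt ℝ B q :=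
  (h.coframe.differentiableOn (by norm_num)).differentiableAt (h.isOpen.mem_nhds hq)

theorem coframe_fderiv_diff (h : IsLeviCivitaFrame U G B gF C) (hq : q ∈ U) :
    DifferentiableAt ℝ (fderiv ℝ B) q :=
  ((h.coframe.fderiv_of_isOpen h.isOpen (m := 1) (by norm_num)).differentiableOn
    (by norm_num)).differentiableAt (h.isOpen.mem_nhds hq)

theorem coframe_frameConn (h : IsLeviCivitaFrame U G B gF C) (hq : q ∈ U) (u v : E n) :
    B q (frameConn B C q u v) = fderiv ℝ B q u v + C q (B q u) (B q v) :=
  h.coframe_inverse hq _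

theorem frameConn_symm (h : IsLeviCivitaFrame U G B gF C) (hq : q ∈ U) (u v : E n) :
    frameConn B C q u v = frameConn B C q v u := by
  have := h.torsion q hq u v
  rw [sub_eq_sub_iff_add_eq_add, add_comm (C q _ _)] at this
  unfold frameConn
  rw [this]

theorem frameConn_diff (h : IsLeviCivitaFrame U G B gF C) (hq : q ∈ U) (u v : E n) :
    DifferentiableAt ℝ (fun q => frameConn B C q u v) q := by
  have h1 := h.coframe_diff hq
  have h2 := h.coframe_fderiv_diff hq
  have h3 := h.conn_diff q hq
  have h4 : DifferentiableAt ℝ (fun q => Ring.inverse (B q)) q :=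
    (differentiableAt_inverse (𝕜 := ℝ) (h.isUnit q hq)).comp q h1
  exact h4.clm_apply (((h2.clm_apply (differentiableAt_const u)).clm_apply
    (differentiableAt_const v)).add ((h3.clm_apply (h1.clm_apply
    (differentiableAt_const u))).clm_apply (h1.clm_apply (differentiableAt_const v))))

/-- The product rule for `gF q (B q v) (B q w)` yields a derivative of `gF`, which `compat` splits
into two `C` terms, and two derivatives of `B`. Each `C` term joins a `B` term to form the coframe
components of `frameConn`. -/
theorem metric_fderiv (h : IsLeviCivitaFrame U G B gF C) (hq : q ∈ U) (u v w : E n) :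
    fderiv ℝ (fun q => G q v w) q u
      = G q (frameConn B C q u v) w + G q v (frameConn B C q u w) := by
  have h1 := (h.coframe_diff hq).hasFDerivAt
  have h2 := (h.metric_diff q hq).hasFDerivAt
  have e : (fun q => G q v w) =ᶠ[nhds q] fun q => gF q (B q v) (B q w) := by
    filter_upwards [h.isOpen.mem_nhds hq] with x hx using h.metric_eq x hx v w
  have h3 := (h2.clm_apply (h1.clm_apply (hasFDerivAt_const v q))).clm_apply
    (h1.clm_apply (hasFDerivAt_const w q))
  rw [e.fderiv_eq, h3.fderiv, h.metric_eq q hq, h.metric_eq q hq, h.coframe_frameConn hq,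
    h.coframe_frameConn hq]
  simp [h.compat q hq]
  ring

theorem metric_nondegenerate (h : IsLeviCivitaFrame U G B gF C) (hq : q ∈ U) (u : E n)
    (hu : ∀ v, G q u v = 0) : u = 0 := by
  have : B q u = 0 := by
    refine h.metric_nondeg q hq _ fun c => ?_
    have := hu (Ring.inverse (B q) c)
    rwa [h.metric_eq q hq, h.coframe_inverse hq] at this
  rw [← h.inverse_coframe hq u, this, map_zero]

theorem metric_comm (h : IsLeviCivitaFrame U G B gF C) (hq : q ∈ U) (u v : E n) :
    G q u v = G q v u := by
  rw [h.metric_eq q hq, h.metric_eq q hq, h.metric_symm q hq]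

theorem gram_mulVec (h : IsLeviCivitaFrame U G B gF C) (hq : q ∈ U) (u : E n) (l : Fin n) :
    (gram G q).mulVec (fun k => u k) l = G q u (basisVec l) := by
  rw [h.metric_comm hq]
  conv_rhs => rw [← sum_smul_basisVec u]
  simp [Matrix.mulVec, dotProduct, gram, h.metric_eq q hq, map_sum, mul_comm]

theorem gramInv_mul_gram (h : IsLeviCivitaFrame U G B gF C) (hq : q ∈ U) :
    gramInv G q * gram G q = 1 := by
  refine Matrix.nonsing_inv_mul _ (isUnit_iff_ne_zero.2 fun hdet => ?_)
  obtain ⟨v, hv, hv0⟩ := Matrix.exists_mulVec_eq_zero_iff.2 hdet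
  -- A kernel vector of the Gram matrix is orthogonal to every vector, contradicting nondegeneracy.
  -- No positivity is needed.
  have h0 : (WithLp.toLp 2 v : E n) = 0 := by
    refine h.metric_nondegenerate hq _ fun w => ?_
    rw [h.metric_comm hq, ← sum_smul_basisVec w, h.metric_eq q hq]
    simp only [map_sum, map_smul, sum_apply, smul_apply]
    refine Finset.sum_eq_zero fun l _ => ?_
    rw [← h.metric_eq q hq, h.metric_comm hq, ← h.gram_mulVec hq]
    simp [hv0]
  exact hv (by simpa using h0)

/-- This is the uniqueness of the Levi-Civita connection. With metric compatibility and symmetry,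
the cyclic combination of derivatives of the metric collapses to twice the metric product of the
covariant derivative with the l-th coordinate vector, and the inverse Gram matrix recovers the
components. -/
theorem christoffel_eq (h : IsLeviCivitaFrame U G B gF C) (hq : q ∈ U) (k i j : Fin n) :
    christoffel G k i j q = frameConn B C q (basisVec i) (basisVec j) k := by
  have key : ∀ l, (1 / 2) * (pd i (fun q => gram G q j l) q + pd j (fun q => gram G q i l) q
      - pd l (fun q => gram G q i j) q)
      = (gram G q).mulVec (fun k => frameConn B C q (basisVec i) (basisVec j) k) l := by
    intro l
    rw [h.gram_mulVec hq]
    simp only [pd, gram, Matrix.of_apply, h.metric_fderiv hq]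
    rw [h.frameConn_symm hq (basisVec j) (basisVec i),
      h.frameConn_symm hq (basisVec l) (basisVec i), h.frameConn_symm hq (basisVec l) (basisVec j),
      h.metric_comm hq _ (basisVec j)]
    ring
  calc christoffel G k i j q
      = (gramInv G q).mulVec ((gram G q).mulVec
          (fun k => frameConn B C q (basisVec i) (basisVec j) k)) k := by
        rw [← funext key]
        simp only [christoffel, Matrix.mulVec, dotProduct, Finset.mul_sum]
        exact Finset.sum_congr rfl fun l _ => by ring
    _ = _ := by rw [Matrix.mulVec_mulVec, h.gramInv_mul_gram hq, Matrix.one_mulVec]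

/-- Differentiating the relation `coframe_frameConn`, rather than the definition of `frameConn`,
avoids the derivative of the inverse coframe. -/
theorem coframe_fderiv_frameConn (h : IsLeviCivitaFrame U G B gF C) (hq : q ∈ U) (x v w : E n) :
    B q (fderiv ℝ (fun q => frameConn B C q v w) q x)
      = fderiv ℝ (fderiv ℝ B) q x v w + fderiv ℝ C q x (B q v) (B q w)
        + C q (fderiv ℝ B q x v) (B q w) + C q (B q v) (fderiv ℝ B q x w)
        - fderiv ℝ B q x (frameConn B C q v w) := by
  have h1 := (h.coframe_diff hq).hasFDerivAt
  have h2 := (h.coframe_fderiv_diff hq).hasFDerivAt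
  have h3 := (h.conn_diff q hq).hasFDerivAt
  have h4 := (h.frameConn_diff hq v w).hasFDerivAt
  have e : (fun q => B q (frameConn B C q v w)) =ᶠ[nhds q]
      fun q => fderiv ℝ B q v w + C q (B q v) (B q w) := by
    filter_upwards [h.isOpen.mem_nhds hq] with x hx using h.coframe_frameConn hx v w
  have l := (h1.clm_apply h4).fderiv
  have cv := hasFDerivAt_const (𝕜 := ℝ) v q
  have cw := hasFDerivAt_const (𝕜 := ℝ) w q
  have r := (((h2.clm_apply cv).clm_apply cw).add
    ((h3.clm_apply (h1.clm_apply cv)).clm_apply (h1.clm_apply cw))).fderiv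
  have := DFunLike.congr_fun ((l.symm.trans e.fderiv_eq).trans r) x
  simp at this
  rw [eq_sub_iff_add_eq, this]
  abel

/-- The left side is the curvature of constant coordinate fields, whose brackets vanish. Second
derivatives of `B` cancel by symmetry. The antisymmetrized first derivative of `B` that survives is
replaced through `torsion`, which produces the term `C (C b a - C a b) c`. -/
theorem coframe_curvature (h : IsLeviCivitaFrame U G B gF C) (hq : q ∈ U) (x v w : E n) :
    B q (fderiv ℝ (fun q => frameConn B C q v w) q x - fderiv ℝ (fun q => frameConn B C q x w) q v
      + frameConn B C q x (frameConn B C q v w) - frameConn B C q v (frameConn B C q x w))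
      = frameCurv B C q (B q x) (B q v) (B q w) := by
  have hs : fderiv ℝ (fderiv ℝ B) q x v = fderiv ℝ (fderiv ℝ B) q v x :=
    ((h.coframe.contDiffAt (h.isOpen.mem_nhds hq)).isSymmSndFDerivAt (by simp)) x v
  simp only [map_sub, map_add, h.coframe_fderiv_frameConn hq]
  simp only [h.coframe_frameConn hq, frameCurv, h.inverse_coframe hq, ← h.torsion q hq, hs]
  simp only [map_sub, map_add, sub_apply]
  abel

/-- The coordinate expression is the trace over k of the curvature operator with second slot j and
acted-on vector i; this fixes the order of the arguments of `frameCurv`. -/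
theorem ricciComp_eq (h : IsLeviCivitaFrame U G B gF C) (hq : q ∈ U) (i j : Fin n) :
    ricciComp G i j q = ∑ k, Ring.inverse (B q)
      (frameCurv B C q (B q (basisVec k)) (B q (basisVec j)) (B q (basisVec i))) k := by
  have hpd : ∀ k i j l, pd l (christoffel G k i j) q
      = fderiv ℝ (fun q => frameConn B C q (basisVec j) (basisVec i)) q (basisVec l) k := by
    intro k i j l
    have e : christoffel G k i j =ᶠ[nhds q]
        fun q => frameConn B C q (basisVec j) (basisVec i) k := by
      filter_upwards [h.isOpen.mem_nhds hq] with x hx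
      rw [h.christoffel_eq hx k i j, h.frameConn_symm hx]
    have := ((EuclideanSpace.proj (𝕜 := ℝ) k).hasFDerivAt.comp q
      (h.frameConn_diff hq (basisVec j) (basisVec i)).hasFDerivAt).fderiv
    rw [pd, e.fderiv_eq]
    exact DFunLike.congr_fun this (basisVec l)
  have hconn : ∀ u v k, frameConn B C q u v k
      = ∑ l, v l * frameConn B C q u (basisVec l) k := by
    intro u v k
    rw [← sum_coord_smul]
    conv_lhs => rw [← sum_smul_basisVec v]
    simp only [frameConn, map_sum, map_smul, ← Finset.sum_add_distrib, ← smul_add]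
  simp only [← h.coframe_curvature hq, h.inverse_coframe hq, ricciComp]
  rw [← Finset.sum_add_distrib]
  refine Finset.sum_congr rfl fun k _ => ?_
  simp only [PiLp.sub_apply, PiLp.add_apply]
  rw [hconn _ (frameConn B C q _ _), hconn _ (frameConn B C q _ _), hpd, hpd, add_sub_assoc,
    ← Finset.sum_sub_distrib]
  refine congrArg₂ _ rfl (Finset.sum_congr rfl fun l _ => ?_)
  simp only [h.christoffel_eq hq]
  rw [h.frameConn_symm hq (basisVec j) (basisVec i), h.frameConn_symm hq (basisVec k) (basisVec i)]
  ring

/-- The Ricci tensor of a metric, computed in a moving coframe. -/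
theorem ricciCoord_eq (h : IsLeviCivitaFrame U G B gF C) (hq : q ∈ U) (u v : E n) :
    ricciCoord G q u v = ∑ a, frameCurv B C q (basisVec a) (B q v) (B q u) a := by
  let T : E n →ₗ[ℝ] E n :=
    { toFun := fun a => frameCurv B C q a (B q v) (B q u)
      map_add' := fun a b => by
        simp only [frameCurv, map_add, map_sub, add_apply, sub_apply]
        abel
      map_smul' := fun r a => by
        simp only [frameCurv, map_smul, map_sub, smul_apply, sub_apply, RingHom.id_apply,
          smul_add, smul_sub] }
  have hQ : ∀ a, frameCurv B C q a (B q v) (B q u) = ∑ j, ∑ i, (v j * u i) •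
      frameCurv B C q a (B q (basisVec j)) (B q (basisVec i)) := by
    intro a
    rw [← frameCurv_sum]
    simp only [← map_smul, ← map_sum, sum_smul_basisVec]
  have htr : ∀ L : E n →ₗ[ℝ] E n, LinearMap.trace ℝ (E n) L = ∑ k, L (basisVec k) k := by
    intro L
    rw [LinearMap.trace_eq_sum_inner L (EuclideanSpace.basisFun (Fin n) ℝ)]
    refine Finset.sum_congr rfl fun k _ => ?_
    simp [basisVec, EuclideanSpace.inner_single_left]
  calc ricciCoord G q u v
      = ∑ k, Ring.inverse (B q) (T (B q (basisVec k))) k := by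
        simp only [ricciCoord, h.ricciComp_eq hq, T, LinearMap.coe_mk, AddHom.coe_mk, hQ]
        simp only [map_sum, map_smul, WithLp.ofLp_sum, Finset.sum_apply, PiLp.smul_apply,
          smul_eq_mul, Finset.mul_sum]
        rw [Finset.sum_comm]
        conv_rhs => rw [Finset.sum_comm]
        refine Finset.sum_congr rfl fun i _ => ?_
        rw [Finset.sum_comm]
        simp only [mul_comm (u _)]
    -- The coordinate trace is that of the conjugate of `T` by the coframe, and the trace is
    -- invariant under conjugation.
    _ = LinearMap.trace ℝ (E n) (((Ring.inverse (B q) : E n →L[ℝ] E n) : E n →ₗ[ℝ] E n) ∘ₗ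
          (T ∘ₗ (B q : E n →ₗ[ℝ] E n))) := by
        rw [htr]
        rfl
    _ = LinearMap.trace ℝ (E n) T := by
        rw [LinearMap.trace_comp_comm', LinearMap.comp_assoc]
        congr 1
        ext1 a
        exact congrArg T (h.coframe_inverse hq a)
    _ = _ := htr T

end IsLeviCivitaFrame
end MovingFrame

/-! ### The algebraic identity behind the Ricci formula. -/

/-- The contraction giving the Ricci tensor in a coframe, for the connection coefficients `c` with
derivatives `dc i` along the frame vectors. -/
def ricciContraction {n : ℕ} (c : Fin n → Fin n → Fin n → ℝ)
    (dc : Fin n → Fin n → Fin n → Fin n → ℝ) (i j : Fin n) : ℝ :=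
  ∑ a, (dc a a i j - dc i a a j
    + ∑ d, ((c d i a - c d a i) * c a d j + c a a d * c d i j - c a i d * c d a j))

/-- The shape of the connection coefficients of the ansatz in the coframe `(dx, dy, dz, θ)`. -/
def ansatzCoeff (J : Fin 5 → Fin 3 → ℝ) : Fin 4 → Fin 4 → Fin 4 → ℝ :=
  ![![![J 0 0, J 0 1, J 0 2, 0], ![J 0 1, -J 0 0, 0, -J 3 2], ![J 0 2, 0, -J 0 0, J 3 1],
      ![0, -J 3 2, J 3 1, -2 * J 4 0]],
    ![![-J 0 1, J 0 0, 0, J 3 2], ![J 0 0, J 0 1, J 0 2, 0], ![0, J 0 2, -J 0 1, -J 3 0],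
      ![J 3 2, 0, -J 3 0, -2 * J 4 1]],
    ![![-J 0 2, 0, J 0 0, -J 3 1], ![0, -J 0 2, J 0 1, J 3 0], ![J 0 0, J 0 1, J 0 2, 0],
      ![-J 3 1, J 3 0, 0, -2 * J 4 2]],
    ![![0, -J 2 2 / 2, J 2 1 / 2, J 1 0], ![J 2 2 / 2, 0, -J 2 0 / 2, J 1 1],
      ![-J 2 1 / 2, J 2 0 / 2, 0, J 1 2], ![J 1 0, J 1 1, J 1 2, 0]]]

/-- The connection coefficients of the ansatz in terms of the height `z`, the sign `s` of the
orientation, the value `v` of `V` and the derivatives `f₁`, `V₁` of `f` and `V`. -/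
def ansatzJet (s z v : ℝ) (f₁ V₁ : Fin 3 → ℝ) : Fin 5 → Fin 3 → ℝ :=
  ![fun k => f₁ k + V₁ k / (2 * v) - (if k = 2 then 1 / z else 0),
    fun k => f₁ k - V₁ k / (2 * v),
    fun k => s * V₁ k / z,
    fun k => z ^ 2 / (2 * v ^ 2) * (s * V₁ k / z),
    fun k => z ^ 2 / (2 * v ^ 2) * (f₁ k - V₁ k / (2 * v))]

/-- The derivative of `ansatzJet` along a vector with vertical component `dz`, along which `V` has
derivative `dv` and `f₁`, `V₁` have derivatives `df`, `dV`. -/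
def ansatzJetDeriv (s z v dz dv : ℝ) (f₁ V₁ df dV : Fin 3 → ℝ) : Fin 5 → Fin 3 → ℝ :=
  ![fun k => df k + (dV k / (2 * v) - V₁ k * dv / (2 * v ^ 2)) + (if k = 2 then dz / z ^ 2 else 0),
    fun k => df k - (dV k / (2 * v) - V₁ k * dv / (2 * v ^ 2)),
    fun k => s * (dV k / z - V₁ k * dz / z ^ 2),
    fun k => (z * dz / v ^ 2 - z ^ 2 * dv / v ^ 3) * (s * V₁ k / z)
      + z ^ 2 / (2 * v ^ 2) * (s * (dV k / z - V₁ k * dz / z ^ 2)),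
    fun k => (z * dz / v ^ 2 - z ^ 2 * dv / v ^ 3) * (f₁ k - V₁ k / (2 * v))
      + z ^ 2 / (2 * v ^ 2) * (df k - (dV k / (2 * v) - V₁ k * dv / (2 * v ^ 2)))]

/-- The components of the right-hand side of the Ricci formula in the coframe `(dx, dy, dz, θ)`. -/
def ansatzRicci (s z v : ℝ) (f₁ V₁ : Fin 3 → ℝ) (H : Fin 3 → Fin 3 → ℝ) :
    Fin 4 → Fin 4 → ℝ :=
  let L := z ^ 2 * (H 0 0 + H 1 1 + H 2 2)
  let ff := z ^ 2 * (f₁ 0 * f₁ 0 + f₁ 1 * f₁ 1 + f₁ 2 * f₁ 2)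
  let Vf := z ^ 2 * (V₁ 0 * f₁ 0 + V₁ 1 * f₁ 1 + V₁ 2 * f₁ 2)
  let A := (-2 - L - 2 * ff - v⁻¹ * Vf) / z ^ 2
  let S : Fin 3 → Fin 3 → ℝ := fun i j =>
    -2 * H i j + 2 * (f₁ i * f₁ j) + v⁻¹ * (V₁ i * f₁ j + V₁ j * f₁ i)
  let X0 := -(v⁻¹ ^ 2 * (s * z * (V₁ 1 * f₁ 2 - V₁ 2 * f₁ 1)))
  let X1 := -(v⁻¹ ^ 2 * (s * z * (V₁ 2 * f₁ 0 - V₁ 0 * f₁ 2)))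
  let X2 := -(v⁻¹ ^ 2 * (s * z * (V₁ 0 * f₁ 1 - V₁ 1 * f₁ 0)))
  ![![A + S 0 0, S 0 1, S 0 2, X0], ![S 1 0, A + S 1 1, S 1 2, X1],
    ![S 2 0, S 2 1, A + S 2 2, X2], ![X0, X1, X2, (-L - 2 * ff + v⁻¹ * Vf) * v⁻¹ ^ 2]]

/-- The components of the Hessian in the upper half-space, in terms of the partial derivatives. -/
def hypHess (z : ℝ) (f₁ : Fin 3 → ℝ) (f₂ : Fin 3 → Fin 3 → ℝ) (i j : Fin 3) : ℝ :=
  f₂ i j + ((if j = 2 then f₁ i else 0) + (if i = 2 then f₁ j else 0)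
    - (if i = j then f₁ 2 else 0)) / z

/-- The derivatives of the connection coefficients along the frame vectors. -/
def ansatzFrameDeriv (s z v : ℝ) (f₁ V₁ : Fin 3 → ℝ) (f₂ V₂ : Fin 3 → Fin 3 → ℝ) :
    Fin 4 → Fin 4 → Fin 4 → Fin 4 → ℝ :=
  ![ansatzCoeff (ansatzJetDeriv s z v 0 (V₁ 0) f₁ V₁ (f₂ 0) (V₂ 0)),
    ansatzCoeff (ansatzJetDeriv s z v 0 (V₁ 1) f₁ V₁ (f₂ 1) (V₂ 1)),
    ansatzCoeff (ansatzJetDeriv s z v 1 (V₁ 2) f₁ V₁ (f₂ 2) (V₂ 2)), 0]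

set_option maxHeartbeats 4000000 in
-- The computational core: sixteen rational identities in independent jet variables. The hypothesis
-- `hV` is harmonicity solved for the second z-derivative of V, and `hs` expresses that the
-- orientation sign enters quadratic curvature terms only through its square.
theorem ricciContraction_ansatz (s z v : ℝ) (f₁ V₁ : Fin 3 → ℝ) (f₂ V₂ : Fin 3 → Fin 3 → ℝ)
    (hs : s ^ 2 = 1) (hz : z ≠ 0) (hv : v ≠ 0) (hf₂ : ∀ i j, f₂ i j = f₂ j i)
    (hV₂ : ∀ i j, V₂ i j = V₂ j i) (hV : V₂ 2 2 = V₁ 2 / z - V₂ 0 0 - V₂ 1 1) (i j : Fin 4) :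
    ricciContraction (ansatzCoeff (ansatzJet s z v f₁ V₁)) (ansatzFrameDeriv s z v f₁ V₁ f₂ V₂) i j
      = ansatzRicci s z v f₁ V₁ (hypHess z f₁ f₂) i j := by
  have hs' : s = 1 ∨ s = -1 := by simpa using hs
  have h1 := hf₂ 1 0
  have h2 := hf₂ 2 0
  have h3 := hf₂ 2 1
  have h4 := hV₂ 1 0
  have h5 := hV₂ 2 0
  have h6 := hV₂ 2 1
  fin_cases i <;> fin_cases j <;>
  · simp only [ricciContraction, ansatzFrameDeriv, Fin.sum_univ_four, ansatzCoeff,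
      Matrix.cons_val, Fin.isValue, Pi.zero_apply, Fin.zero_eta, Fin.mk_one, Fin.reduceFinMk]
    simp only [ansatzJet, ansatzJetDeriv, ansatzRicci, hypHess, Matrix.cons_val, Fin.isValue,
      h1, h2, h3, h4, h5, h6, hV, Fin.reduceEq, if_true, if_false]
    -- Fixing the sign as 1 or -1 builds in s² = 1, leaving identities of rational functions.
    rcases hs' with rfl | rfl <;> field_simp <;> ring

/-! ### Hyperbolic tensor calculus in upper half-space coordinates. -/

theorem gram_hyp (p : E 3) (i j : Fin 3) : gram hyp p i j = if i = j then 1 / p 2 ^ 2 else 0 := by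
  by_cases h : i = j
  · subst h; simp [gram, hyp, basisVec, EuclideanSpace.inner_single_left]
  · have : j ≠ i := fun e => h e.symm
    simp [gram, hyp, basisVec, EuclideanSpace.inner_single_left, h]

theorem gram_hyp_eq_smul (p : E 3) : gram hyp p = (1 / p 2 ^ 2) • (1 : Matrix (Fin 3) (Fin 3) ℝ) := by
  ext i j
  simp [gram_hyp, Matrix.one_apply]

theorem gramInv_hyp {p : E 3} (hp : p 2 ≠ 0) (i j : Fin 3) :
    gramInv hyp p i j = if i = j then p 2 ^ 2 else 0 := by
  have : gramInv hyp p = (p 2 ^ 2) • (1 : Matrix (Fin 3) (Fin 3) ℝ) := by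
    refine Matrix.inv_eq_left_inv ?_
    rw [gram_hyp_eq_smul]
    simp [smul_smul, hp]
  simp [this, Matrix.one_apply]

theorem hasFDerivAt_coord {n : ℕ} (k : Fin n) (p : E n) :
    HasFDerivAt (fun q : E n => q k) (EuclideanSpace.proj (𝕜 := ℝ) k) p :=
  (EuclideanSpace.proj (𝕜 := ℝ) k).hasFDerivAt

theorem pd_gram_hyp {p : E 3} (hp : p 2 ≠ 0) (l i j : Fin 3) :
    pd l (fun q => gram hyp q i j) p = if i = j ∧ l = 2 then -2 / p 2 ^ 3 else 0 := by
  by_cases h : i = j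
  · have h1 := ((hasDerivAt_pow 2 (p 2)).inv (pow_ne_zero 2 hp)).comp_hasFDerivAt p
      (hasFDerivAt_coord 2 p)
    have h2 : (fun q => gram hyp q i j) = (fun x : ℝ => x ^ 2)⁻¹ ∘ fun q : E 3 => q 2 := by
      funext q; simp [gram_hyp, h]
    rw [pd, h2, h1.fderiv]
    by_cases hl : l = 2
    · subst hl
      simp [h, basisVec]
      field_simp
    · simp [h, hl, basisVec, Ne.symm hl]
  · simp [pd, gram_hyp, h]

theorem christoffel_hyp {p : E 3} (hp : p 2 ≠ 0) (k i j : Fin 3) :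
    christoffel hyp k i j p = -((if j = 2 ∧ k = i then 1 else 0) + (if i = 2 ∧ k = j then 1 else 0)
      - (if i = j ∧ k = 2 then 1 else 0)) / p 2 := by
  simp only [christoffel, gramInv_hyp hp, pd_gram_hyp hp, Fin.sum_univ_three]
  fin_cases k <;> fin_cases i <;> fin_cases j <;> simp <;> field_simp

theorem hessian_hyp {p : E 3} (hp : p 2 ≠ 0) (f : E 3 → ℝ) (u v : E 3) :
    hessian hyp f p u v = ∑ i, ∑ j, u i * v j *
      hypHess (p 2) (fun k => pd k f p) (fun k l => pd k (pd l f) p) i j := by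
  refine Finset.sum_congr rfl fun i _ => Finset.sum_congr rfl fun j _ => ?_
  simp only [christoffel_hyp hp, Fin.sum_univ_three, hypHess]
  fin_cases i <;> fin_cases j <;> simp <;> ring_nf <;> simp

theorem laplacian_hyp {p : E 3} (hp : p 2 ≠ 0) (f : E 3 → ℝ) :
    laplacian hyp f p = p 2 ^ 2 * ∑ i,
      hypHess (p 2) (fun k => pd k f p) (fun k l => pd k (pd l f) p) i i := by
  simp [laplacian, hessian_hyp hp, gramInv_hyp hp, Finset.mul_sum, basisVec]

theorem cometric_hyp {p : E 3} (hp : p 2 ≠ 0) (α β : E 3 → ℝ) :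
    cometric hyp p α β = p 2 ^ 2 * ∑ i, α (basisVec i) * β (basisVec i) := by
  simp [cometric, gramInv_hyp hp, Finset.mul_sum, mul_assoc]

/-- An orientation either agrees with that of the standard basis or is opposite to it. The sign `s`
allows both to be treated at once: it enters through ⋆dV in the connection and through ⋆(dV ∧ df) in
the result. -/
theorem exists_volumeForm_eq (o : Orientation ℝ (E 3) (Fin 3)) : ∃ s : ℝ, s ^ 2 = 1 ∧
    ∀ u v w, o.volumeForm ![u, v, w] = s * (u 0 * (v 1 * w 2 - v 2 * w 1)
      - u 1 * (v 0 * w 2 - v 2 * w 0) + u 2 * (v 0 * w 1 - v 1 * w 0)) := by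
  let b := EuclideanSpace.basisFun (Fin 3) ℝ
  have hdet : ∀ u v w : E 3, b.toBasis.det ![u, v, w] = (u 0 * (v 1 * w 2 - v 2 * w 1)
      - u 1 * (v 0 * w 2 - v 2 * w 0) + u 2 * (v 0 * w 1 - v 1 * w 0)) := by
    intro u v w
    rw [Module.Basis.det_apply, Matrix.det_fin_three]
    simp [Module.Basis.toMatrix_apply, b]
    ring
  by_cases ho : b.toBasis.orientation = o
  · refine ⟨1, by norm_num, fun u v w => ?_⟩
    rw [o.volumeForm_robust b ho, hdet, one_mul]
  · refine ⟨-1, by norm_num, fun u v w => ?_⟩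
    rw [o.volumeForm_robust_neg b ho, AlternatingMap.neg_apply, hdet, neg_one_mul]

theorem volForm_hyp {o : Orientation ℝ (E 3) (Fin 3)} {s : ℝ}
    (hs : ∀ u v w, o.volumeForm ![u, v, w] = s * (u 0 * (v 1 * w 2 - v 2 * w 1)
      - u 1 * (v 0 * w 2 - v 2 * w 0) + u 2 * (v 0 * w 1 - v 1 * w 0)))
    {p : E 3} (hp : 0 < p 2) (u v w : E 3) :
    volForm o hyp p u v w = s * (u 0 * (v 1 * w 2 - v 2 * w 1)
      - u 1 * (v 0 * w 2 - v 2 * w 0) + u 2 * (v 0 * w 1 - v 1 * w 0)) / p 2 ^ 3 := by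
  -- The determinant is written as a square, so that positivity of the height gives its root z⁻³.
  have : (gram hyp p).det = ((1 / p 2) ^ 3) ^ 2 := by
    rw [gram_hyp_eq_smul, Matrix.det_smul]
    simp
    ring
  rw [volForm, this, Real.sqrt_sq (by positivity), hs]
  field_simp

theorem starOne_hyp {o : Orientation ℝ (E 3) (Fin 3)} {s : ℝ}
    (hs : ∀ u v w, o.volumeForm ![u, v, w] = s * (u 0 * (v 1 * w 2 - v 2 * w 1)
      - u 1 * (v 0 * w 2 - v 2 * w 0) + u 2 * (v 0 * w 1 - v 1 * w 0)))
    {p : E 3} (hp : 0 < p 2) (α : E 3 → ℝ) (u v : E 3) :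
    starOne o hyp p α u v = s * (α (basisVec 0) * (u 1 * v 2 - u 2 * v 1)
      - α (basisVec 1) * (u 0 * v 2 - u 2 * v 0)
      + α (basisVec 2) * (u 0 * v 1 - u 1 * v 0)) / p 2 := by
  rw [starOne, volForm_hyp hs hp]
  simp [sharp, gramInv_hyp hp.ne', basisVec, Fin.sum_univ_three]
  field_simp

theorem starTwo_wedge_hyp {o : Orientation ℝ (E 3) (Fin 3)} {s : ℝ}
    (hs : ∀ u v w, o.volumeForm ![u, v, w] = s * (u 0 * (v 1 * w 2 - v 2 * w 1)
      - u 1 * (v 0 * w 2 - v 2 * w 0) + u 2 * (v 0 * w 1 - v 1 * w 0)))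
    {p : E 3} (hp : 0 < p 2) (α β : E 3 → ℝ) (u : E 3) :
    starTwo o hyp p (wedge α β) u = s * p 2 * (
      (α (basisVec 1) * β (basisVec 2) - α (basisVec 2) * β (basisVec 1)) * u 0
      + (α (basisVec 2) * β (basisVec 0) - α (basisVec 0) * β (basisVec 2)) * u 1
      + (α (basisVec 0) * β (basisVec 1) - α (basisVec 1) * β (basisVec 0)) * u 2) := by
  simp only [starTwo, volForm_hyp hs hp, gramInv_hyp hp.ne']
  simp [wedge, basisVec, Fin.sum_univ_three]
  field_simp
  ring

/-! ### Bilinear maps from components -/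

section Components

variable {n : ℕ}

/-- The vector-valued bilinear map with given components. -/
def coeffMap : (Fin n → Fin n → Fin n → ℝ) →L[ℝ] E n →L[ℝ] E n →L[ℝ] E n :=
  ∑ k, ∑ i, ∑ j,
    ((ContinuousLinearMap.proj j : (Fin n → ℝ) →L[ℝ] ℝ) ∘L
      (ContinuousLinearMap.proj i : (Fin n → Fin n → ℝ) →L[ℝ] Fin n → ℝ) ∘L
      (ContinuousLinearMap.proj k : (Fin n → Fin n → Fin n → ℝ) →L[ℝ] Fin n → Fin n → ℝ)).smulRight
      ((EuclideanSpace.proj (𝕜 := ℝ) i : E n →L[ℝ] ℝ).smulRight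
        ((EuclideanSpace.proj (𝕜 := ℝ) j : E n →L[ℝ] ℝ).smulRight (basisVec k : E n)))

theorem coeffMap_apply (c : Fin n → Fin n → Fin n → ℝ) (a b : E n) (k : Fin n) :
    coeffMap c a b k = ∑ i, ∑ j, c k i j * (a i * b j) := by
  simp [coeffMap, basisVec, Pi.single_apply]

theorem coeffMap_basisVec (c : Fin n → Fin n → Fin n → ℝ) (i j k : Fin n) :
    coeffMap c (basisVec i) (basisVec j) k = c k i j := by
  simp [coeffMap_apply, basisVec]

/-- The diagonal bilinear form with given entries. -/
def diagForm : (Fin n → ℝ) →L[ℝ] E n →L[ℝ] E n →L[ℝ] ℝ :=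
  ∑ i, (ContinuousLinearMap.proj i : (Fin n → ℝ) →L[ℝ] ℝ).smulRight
    ((EuclideanSpace.proj (𝕜 := ℝ) i : E n →L[ℝ] ℝ).smulRight
      (EuclideanSpace.proj (𝕜 := ℝ) i : E n →L[ℝ] ℝ))

theorem diagForm_apply (w : Fin n → ℝ) (a b : E n) :
    diagForm w a b = ∑ i, w i * (a i * b i) := by
  simp [diagForm]

/-- Passage from bilinear maps to arrays: `frameCurv` is expanded bilinearly in its last two
arguments, and its value on basis vectors is read off from `c` and `dc`. -/
theorem sum_frameCurv_coeffMap {B : E n → E n →L[ℝ] E n} {C : E n → E n →L[ℝ] E n →L[ℝ] E n}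
    {q : E n} {c : Fin n → Fin n → Fin n → ℝ} {dc : Fin n → Fin n → Fin n → Fin n → ℝ}
    (hC : C q = coeffMap c)
    (hdC : ∀ i, fderiv ℝ C q (Ring.inverse (B q) (basisVec i)) = coeffMap (dc i)) (v u : E n) :
    ∑ a, frameCurv B C q (basisVec a) v u a
      = ∑ i, ∑ j, v i * u j * ricciContraction c dc i j := by
  have key : ∀ a i j, frameCurv B C q (basisVec a) (basisVec i) (basisVec j) a
      = dc a a i j - dc i a a j
        + ∑ d, ((c d i a - c d a i) * c a d j + c a a d * c d i j - c a i d * c d a j) := by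
    intro a i j
    have h1 : ∀ x (k : Fin n), coeffMap c x (basisVec j) k = ∑ d, x d * c k d j := by
      intro x k
      simp [coeffMap_apply, basisVec, mul_comm]
    have h2 : ∀ x (k l : Fin n), coeffMap c (basisVec l) x k = ∑ d, x d * c k l d := by
      intro x k l
      rw [coeffMap_apply, Finset.sum_comm]
      simp [basisVec, mul_comm]
    have h3 : ∀ (l : Fin n) (F : Fin n → ℝ), ∑ d, (basisVec l : E n) d * F d = F l := by
      intro l F
      simp [basisVec]
    simp only [frameCurv, hC, hdC, PiLp.add_apply, PiLp.sub_apply, h1, h2, h3,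
      Finset.sum_add_distrib, Finset.sum_sub_distrib, map_sub, sub_apply, sub_mul]
    simp only [coeffMap_basisVec, mul_comm]
    ring
  have hsum := fun a => frameCurv_sum B C q (basisVec a) v u basisVec basisVec
  simp only [sum_smul_basisVec] at hsum
  simp only [ricciContraction, ← key, hsum, WithLp.ofLp_sum, Finset.sum_apply, PiLp.smul_apply,
    smul_eq_mul, Finset.mul_sum]
  rw [Finset.sum_comm]
  exact Finset.sum_congr rfl fun i _ => Finset.sum_comm

end Components

/-! ### The derivative of the connection coefficients -/

/-- One-variable quotient and product rules along a curve; applied to straight lines they give the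
directional derivatives of the jet. -/
theorem hasDerivAt_ansatzJet (s : ℝ) {z v : ℝ → ℝ} {f₁ V₁ : Fin 3 → ℝ → ℝ} {t dz dv : ℝ}
    {df dV : Fin 3 → ℝ} (hz : z t ≠ 0) (hv : v t ≠ 0) (hz' : HasDerivAt z dz t)
    (hv' : HasDerivAt v dv t) (hf : ∀ k, HasDerivAt (f₁ k) (df k) t)
    (hV : ∀ k, HasDerivAt (V₁ k) (dV k) t) :
    HasDerivAt (fun t => ansatzJet s (z t) (v t) (fun k => f₁ k t) (fun k => V₁ k t))
      (ansatzJetDeriv s (z t) (v t) dz dv (fun k => f₁ k t) (fun k => V₁ k t) df dV) t := by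
  have h2v : ∀ k, HasDerivAt (fun t => V₁ k t / (2 * v t))
      (dV k / (2 * v t) - V₁ k t * dv / (2 * v t ^ 2)) t := fun k =>
    ((hV k).div (hv'.const_mul 2) (by simpa using hv)).congr_deriv (by field_simp)
  have hb : ∀ k, HasDerivAt (fun t => s * V₁ k t / z t)
      (s * (dV k / z t - V₁ k t * dz / z t ^ 2)) t := fun k =>
    (((hV k).const_mul s).div hz' hz).congr_deriv (by field_simp)
  have hκ : HasDerivAt (fun t => z t ^ 2 / (2 * v t ^ 2))
      (z t * dz / v t ^ 2 - z t ^ 2 * dv / v t ^ 3) t :=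
    ((hz'.pow 2).div ((hv'.pow 2).const_mul 2) (by simpa using hv)).congr_deriv
      (by simp; field_simp)
  have hδ : ∀ k : Fin 3, HasDerivAt (fun t => if k = 2 then 1 / z t else 0)
      (-(if k = 2 then dz / z t ^ 2 else 0)) t := by
    intro k
    split_ifs
    · exact (((hasDerivAt_const t (1 : ℝ)).div hz' hz).congr_deriv (by field_simp; simp))
    · simpa using hasDerivAt_const t (0 : ℝ)
  refine hasDerivAt_pi.2 fun a => hasDerivAt_pi.2 fun k => ?_
  fin_cases a
  · exact (((hf k).add (h2v k)).sub (hδ k)).congr_deriv (sub_neg_eq_add _ _)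
  · exact (hf k).sub (h2v k)
  · exact hb k
  · exact hκ.mul (hb k)
  · exact hκ.mul ((hf k).sub (h2v k))

/-! ### The ansatz in coordinates -/

/-- The inclusion of the base coordinates in the coordinates of the total space. -/
def baseIncl : E 3 →L[ℝ] E 4 :=
  ∑ i, (EuclideanSpace.proj (𝕜 := ℝ) i : E 3 →L[ℝ] ℝ).smulRight (basisVec i.castSucc : E 4)

theorem baseIncl_apply (x : E 3) :
    baseIncl x 0 = x 0 ∧ baseIncl x 1 = x 1 ∧ baseIncl x 2 = x 2 ∧ baseIncl x 3 = 0 := by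
  refine ⟨?_, ?_, ?_, ?_⟩ <;> simp [baseIncl, Fin.sum_univ_three, basisVec]

/-- The coframe consisting of the differential of `p` and a further `1`-form. -/
def ansatzCoframe (p : E 4 → E 3) (θ : E 4 → E 4 →L[ℝ] ℝ) (q : E 4) : E 4 →L[ℝ] E 4 :=
  baseIncl ∘L fderiv ℝ p q + (θ q).smulRight (basisVec 3 : E 4)

theorem ansatzCoframe_apply (p : E 4 → E 3) (θ : E 4 → E 4 →L[ℝ] ℝ) (q u : E 4) :
    ansatzCoframe p θ q u 0 = fderiv ℝ p q u 0 ∧ ansatzCoframe p θ q u 1 = fderiv ℝ p q u 1 ∧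
    ansatzCoframe p θ q u 2 = fderiv ℝ p q u 2 ∧ ansatzCoframe p θ q u 3 = θ q u := by
  obtain ⟨h0, h1, h2, h3⟩ := baseIncl_apply (fderiv ℝ p q u)
  refine ⟨?_, ?_, ?_, ?_⟩ <;> simp [ansatzCoframe, h0, h1, h2, h3, basisVec]

/-- The data of the ansatz in a coordinate chart. -/
structure IsAnsatzChart (o : Orientation ℝ (E 3) (Fin 3)) (𝒱 : Set (E 3)) (V : E 3 → ℝ)
    (U : Set (E 4)) (p : E 4 → E 3) (θ : E 4 → E 4 →L[ℝ] ℝ) : Prop where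
  isOpen : IsOpen U
  mapsTo : ∀ q ∈ U, p q ∈ 𝒱
  smooth_proj : ContDiffOn ℝ ∞ p U
  smooth_form : ContDiffOn ℝ ∞ θ U
  injective : ∀ q ∈ U, ∀ u, fderiv ℝ p q u = 0 → θ q u = 0 → u = 0
  curvature : ∀ q ∈ U, ∀ u v, fderiv ℝ θ q u v - fderiv ℝ θ q v u
    = starOne o hyp (p q) (fderiv ℝ V (p q)) (fderiv ℝ p q u) (fderiv ℝ p q v)

/-! ### Derivatives of the jet and of the metric entries on the base. -/

section

variable {o : Orientation ℝ (E 3) (Fin 3)} {𝒱 : Set (E 3)} {V f : E 3 → ℝ}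

theorem fderiv_eq_sum_pd {n : ℕ} (F : E n → ℝ) (x w : E n) :
    fderiv ℝ F x w = ∑ k, w k * pd k F x := by
  conv_lhs => rw [← sum_smul_basisVec w]
  simp [pd]

theorem contDiffOn_pd {n : ℕ} {F : E n → ℝ} {s : Set (E n)} (hs : IsOpen s)
    (hF : ContDiffOn ℝ 2 F s) (k : Fin n) : ContDiffOn ℝ 1 (pd k F) s :=
  (hF.fderiv_of_isOpen hs (m := 1) (by norm_num)).clm_apply contDiffOn_const

theorem pd_comm {n : ℕ} {F : E n → ℝ} {s : Set (E n)} (hs : IsOpen s)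
    (hF : ContDiffOn ℝ 2 F s) {x : E n} (hx : x ∈ s) (k l : Fin n) :
    pd k (pd l F) x = pd l (pd k F) x := by
  have hd : DifferentiableAt ℝ (fderiv ℝ F) x :=
    ((hF.fderiv_of_isOpen hs (m := 1) (by norm_num)).differentiableOn
      (by norm_num)).differentiableAt (hs.mem_nhds hx)
  have h : ∀ k l, pd k (pd l F) x = fderiv ℝ (fderiv ℝ F) x (basisVec k) (basisVec l) := by
    intro k l
    have := (hd.hasFDerivAt.clm_apply (hasFDerivAt_const (basisVec l : E n) x)).fderiv
    change fderiv ℝ (fun y => fderiv ℝ F y (basisVec l)) x (basisVec k) = _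
    rw [this]
    simp
  rw [h, h]
  exact ((hF.contDiffAt (hs.mem_nhds hx)).isSymmSndFDerivAt (by simp)) _ _

/-- The jet of `f` and `V` which determines the Levi-Civita connection of the ansatz. -/
def ansatzJetAt (s : ℝ) (V f : E 3 → ℝ) (x : E 3) : Fin 5 → Fin 3 → ℝ :=
  ansatzJet s (x 2) (V x) (fun k => pd k f x) (fun k => pd k V x)

/-- The diagonal entries of the ansatz metric. -/
def ansatzDiag (V f : E 3 → ℝ) (x : E 3) : Fin 4 → ℝ :=
  ![Real.exp (2 * f x) * V x / x 2 ^ 2, Real.exp (2 * f x) * V x / x 2 ^ 2,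
    Real.exp (2 * f x) * V x / x 2 ^ 2, Real.exp (2 * f x) / V x]

/-- `ansatzCoeff` as a continuous linear map. -/
def ansatzCoeffL : (Fin 5 → Fin 3 → ℝ) →L[ℝ] Fin 4 → Fin 4 → Fin 4 → ℝ :=
  LinearMap.toContinuousLinearMap
    { toFun := ansatzCoeff
      map_add' := fun J K => by
        ext i j k
        fin_cases i <;> fin_cases j <;> fin_cases k <;> simp [ansatzCoeff] <;> ring
      map_smul' := fun r J => by
        ext i j k
        fin_cases i <;> fin_cases j <;> fin_cases k <;> simp [ansatzCoeff] <;> ring }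

theorem differentiableAt_ansatzJetAt (s : ℝ) {x : E 3} (hz : x 2 ≠ 0) (hv : V x ≠ 0)
    (hV : DifferentiableAt ℝ V x) (hV' : ∀ k, DifferentiableAt ℝ (pd k V) x)
    (hf' : ∀ k, DifferentiableAt ℝ (pd k f) x) : DifferentiableAt ℝ (ansatzJetAt s V f) x := by
  have hz' : DifferentiableAt ℝ (fun x : E 3 => x 2) x := (hasFDerivAt_coord 2 x).differentiableAt
  have hv2 : 2 * V x ≠ 0 := by simpa using hv
  have hv3 : 2 * V x ^ 2 ≠ 0 := by simpa using hv
  have h2 : ∀ k, DifferentiableAt ℝ (fun x => pd k V x / (2 * V x)) x := fun k => by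
    fun_prop (disch := assumption)
  have hb : ∀ k, DifferentiableAt ℝ (fun x => s * pd k V x / x 2) x := fun k => by
    fun_prop (disch := assumption)
  have hκ : DifferentiableAt ℝ (fun x : E 3 => x 2 ^ 2 / (2 * V x ^ 2)) x := by
    fun_prop (disch := assumption)
  refine differentiableAt_pi.2 fun a => differentiableAt_pi.2 fun k => ?_
  fin_cases a
  · refine ((hf' k).add (h2 k)).sub ?_
    split_ifs
    · fun_prop (disch := assumption)
    · exact differentiableAt_const _
  · exact (hf' k).sub (h2 k)
  · exact hb k
  · exact hκ.mul (hb k)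
  · exact hκ.mul ((hf' k).sub (h2 k))

theorem fderiv_ansatzJetAt (s : ℝ) {x : E 3} (hz : x 2 ≠ 0) (hv : V x ≠ 0)
    (hV : DifferentiableAt ℝ V x) (hV' : ∀ k, DifferentiableAt ℝ (pd k V) x)
    (hf' : ∀ k, DifferentiableAt ℝ (pd k f) x) (w : E 3) :
    fderiv ℝ (ansatzJetAt s V f) x w = ansatzJetDeriv s (x 2) (V x) (w 2) (fderiv ℝ V x w)
      (fun k => pd k f x) (fun k => pd k V x) (fun k => fderiv ℝ (pd k f) x w)
      (fun k => fderiv ℝ (pd k V) x w) := by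
  have hd := differentiableAt_ansatzJetAt s hz hv hV hV' hf'
  have h0 : x + (0 : ℝ) • w = x := by simp
  -- Since the jet is differentiable, its derivative on `w` can be computed along the line t ↦ x + t
  -- w.
  have := hasDerivAt_ansatzJet s (t := 0) (z := fun t => (x + t • w) 2)
    (v := fun t => V (x + t • w)) (f₁ := fun k t => pd k f (x + t • w))
    (V₁ := fun k t => pd k V (x + t • w)) (by simpa [h0] using hz) (by simpa [h0] using hv)
    (((hasFDerivAt_coord 2 x).hasLineDerivAt w)) (hV.hasFDerivAt.hasLineDerivAt w)
    (fun k => (hf' k).hasFDerivAt.hasLineDerivAt w) (fun k => (hV' k).hasFDerivAt.hasLineDerivAt w)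
  simp only [h0] at this
  exact HasDerivAt.unique (hd.hasFDerivAt.hasLineDerivAt w) this

/-- Rows 0 and 1 of the jet are half the logarithmic derivatives of the base and fibre entries.
These rows do not involve the sign, so `s` is arbitrary here. -/
theorem fderiv_ansatzDiag {x : E 3} (hz : x 2 ≠ 0) (hv : V x ≠ 0)
    (hV : DifferentiableAt ℝ V x) (hf : DifferentiableAt ℝ f x) (s : ℝ) :
    DifferentiableAt ℝ (ansatzDiag V f) x ∧
    ∀ w i, fderiv ℝ (ansatzDiag V f) x w i = 2 * ansatzDiag V f x i *
      ∑ k, w k * ansatzJetAt s V f x (if i = 3 then 1 else 0) k := by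
  have hz' : DifferentiableAt ℝ (fun x : E 3 => x 2) x := (hasFDerivAt_coord 2 x).differentiableAt
  have hz2 : x 2 ^ 2 ≠ 0 := pow_ne_zero 2 hz
  have hb : DifferentiableAt ℝ (fun x => Real.exp (2 * f x) * V x / x 2 ^ 2) x := by
    fun_prop (disch := assumption)
  have hf' : DifferentiableAt ℝ (fun x => Real.exp (2 * f x) / V x) x := by
    fun_prop (disch := assumption)
  have hd : DifferentiableAt ℝ (ansatzDiag V f) x := by
    refine differentiableAt_pi.2 fun i => ?_
    fin_cases i
    exacts [hb, hb, hb, hf']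
  refine ⟨hd, fun w i => ?_⟩
  have h0 : x + (0 : ℝ) • w = x := by simp
  have hvt : V (x + (0 : ℝ) • w) ≠ 0 := by simpa using hv
  have hzt : (x + (0 : ℝ) • w) 2 ^ 2 ≠ 0 := by simpa using hz
  have he := ((hf.hasFDerivAt.hasLineDerivAt w).const_mul 2).exp
  have hVl := hV.hasFDerivAt.hasLineDerivAt w
  have hzl : HasDerivAt (fun t : ℝ => (x + t • w) 2) (w 2) 0 :=
    (hasFDerivAt_coord 2 x).hasLineDerivAt w
  have h1 := (he.mul hVl).div (hzl.pow 2) hzt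
  have h2 := he.div hVl hvt
  have hi := hasDerivAt_pi.1 (hd.hasFDerivAt.hasLineDerivAt w) i
  have hbase : ((Real.exp (2 * f x) * (2 * fderiv ℝ f x w) * V x
      + Real.exp (2 * f x) * fderiv ℝ V x w) * x 2 ^ 2
      - Real.exp (2 * f x) * V x * (2 * x 2 * w 2)) / (x 2 ^ 2) ^ 2
      = 2 * (Real.exp (2 * f x) * V x / x 2 ^ 2) * ∑ k, w k * ansatzJetAt s V f x 0 k := by
    rw [fderiv_eq_sum_pd f, fderiv_eq_sum_pd V]
    simp [Fin.sum_univ_three, ansatzJetAt, ansatzJet]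
    field_simp
    ring
  have hfib : (Real.exp (2 * f x) * (2 * fderiv ℝ f x w) * V x
      - Real.exp (2 * f x) * fderiv ℝ V x w) / V x ^ 2
      = 2 * (Real.exp (2 * f x) / V x) * ∑ k, w k * ansatzJetAt s V f x 1 k := by
    rw [fderiv_eq_sum_pd f, fderiv_eq_sum_pd V]
    simp [Fin.sum_univ_three, ansatzJetAt, ansatzJet]
    field_simp
    ring
  simp only [h0] at h1 h2
  norm_num [pow_one] at h1
  fin_cases i
  · exact (hi.unique h1).trans hbase
  · exact (hi.unique h1).trans hbase
  · exact (hi.unique h1).trans hbase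
  · exact (hi.unique h2).trans hfib

end

/-! ### The Levi-Civita connection and the Ricci tensor of the ansatz in a chart. -/

section

variable {o : Orientation ℝ (E 3) (Fin 3)} {𝒱 : Set (E 3)} {V f : E 3 → ℝ} {s : ℝ}
  {U : Set (E 4)} {p : E 4 → E 3} {θ : E 4 → E 4 →L[ℝ] ℝ} {q : E 4}
  {G : E 4 → E 4 → E 4 → ℝ}

/-- The ansatz metric in a coordinate chart. -/
def ansatzChartMetric (p : E 4 → E 3) (θ : E 4 → E 4 →L[ℝ] ℝ) (V f : E 3 → ℝ) (q u v : E 4) : ℝ :=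
  Real.exp (2 * f (p q)) * (V (p q) * hyp (p q) (fderiv ℝ p q u) (fderiv ℝ p q v)
    + (V (p q))⁻¹ * (θ q u * θ q v))

/-- The connection coefficients of the ansatz metric. -/
def ansatzConn (s : ℝ) (p : E 4 → E 3) (V f : E 3 → ℝ) (q : E 4) : E 4 →L[ℝ] E 4 →L[ℝ] E 4 :=
  coeffMap (ansatzCoeffL (ansatzJetAt s V f (p q)))

theorem fderiv_ansatzCoframe (hB : DifferentiableAt ℝ (ansatzCoframe p θ) q)
    (hp : DifferentiableAt ℝ (fderiv ℝ p) q)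
    (hθ : DifferentiableAt ℝ θ q) (u v : E 4) : fderiv ℝ (ansatzCoframe p θ) q u v
      = baseIncl (fderiv ℝ (fderiv ℝ p) q u v) + fderiv ℝ θ q u v • basisVec 3 := by
  have h1 := ((hasFDerivAt_const baseIncl q).clm_comp hp.hasFDerivAt).clm_apply
    (hasFDerivAt_const v q)
  have h2 := (hθ.hasFDerivAt.clm_apply (hasFDerivAt_const v q)).smul_const (basisVec 3 : E 4)
  have h3 := (hB.hasFDerivAt.clm_apply (hasFDerivAt_const v q)).unique (h1.add h2)
  have := DFunLike.congr_fun h3 u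
  simpa using this

theorem contDiffOn_ansatzCoframe (h : IsAnsatzChart o 𝒱 V U p θ) :
    ContDiffOn ℝ ∞ (ansatzCoframe p θ) U :=
  (contDiffOn_const.clm_comp (h.smooth_proj.fderiv_of_isOpen h.isOpen (m := ∞) (by simp))).add
    (h.smooth_form.smulRight contDiffOn_const)

theorem two_le_infty : (2 : WithTop ℕ∞) ≤ ∞ :=
  ENat.LEInfty.out

theorem hyp_eq (x u v : E 3) : hyp x u v = (u 0 * v 0 + u 1 * v 1 + u 2 * v 2) / x 2 ^ 2 := by
  simp [hyp, PiLp.inner_apply, Fin.sum_univ_three, mul_comm]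

/-- Metric compatibility comes from the logarithmic derivatives in `fderiv_ansatzDiag`, the
off-diagonal contributions cancelling through the ratio z²/V². Vanishing torsion is the curvature
equation for θ together with closedness of the three base forms. -/
theorem isLeviCivitaFrame_ansatz (h : IsAnsatzChart o 𝒱 V U p θ)
    (hG : ∀ q ∈ U, ∀ u v, G q u v = ansatzChartMetric p θ V f q u v) (h𝒱 : IsOpen 𝒱)
    (h𝒱H : 𝒱 ⊆ upperHalfSpace) (hVpos : ∀ x ∈ 𝒱, 0 < V x) (hV : ContDiffOn ℝ 2 V 𝒱)
    (hf : ContDiffOn ℝ 2 f 𝒱)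
    (hs : ∀ u v w, o.volumeForm ![u, v, w] = s * (u 0 * (v 1 * w 2 - v 2 * w 1)
      - u 1 * (v 0 * w 2 - v 2 * w 0) + u 2 * (v 0 * w 1 - v 1 * w 0))) :
    IsLeviCivitaFrame U G (ansatzCoframe p θ)
      (fun q => diagForm (ansatzDiag V f (p q))) (ansatzConn s p V f) := by
  have hz : ∀ q ∈ U, 0 < p q 2 := fun q hq => h𝒱H (h.mapsTo q hq)
  have hv : ∀ q ∈ U, 0 < V (p q) := fun q hq => hVpos _ (h.mapsTo q hq)
  have hVd : ∀ q ∈ U, DifferentiableAt ℝ V (p q) := fun q hq =>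
    (hV.differentiableOn (by norm_num)).differentiableAt (h𝒱.mem_nhds (h.mapsTo q hq))
  have hfd : ∀ q ∈ U, DifferentiableAt ℝ f (p q) := fun q hq =>
    (hf.differentiableOn (by norm_num)).differentiableAt (h𝒱.mem_nhds (h.mapsTo q hq))
  have hV'd : ∀ q ∈ U, ∀ k, DifferentiableAt ℝ (pd k V) (p q) := fun q hq k =>
    ((contDiffOn_pd h𝒱 hV k).differentiableOn (by norm_num)).differentiableAt
      (h𝒱.mem_nhds (h.mapsTo q hq))
  have hf'd : ∀ q ∈ U, ∀ k, DifferentiableAt ℝ (pd k f) (p q) := fun q hq k =>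
    ((contDiffOn_pd h𝒱 hf k).differentiableOn (by norm_num)).differentiableAt
      (h𝒱.mem_nhds (h.mapsTo q hq))
  have hpd : ∀ q ∈ U, DifferentiableAt ℝ p q := fun q hq =>
    (h.smooth_proj.differentiableOn (by simp)).differentiableAt (h.isOpen.mem_nhds hq)
  have hp'd : ∀ q ∈ U, DifferentiableAt ℝ (fderiv ℝ p) q := fun q hq =>
    ((h.smooth_proj.fderiv_of_isOpen h.isOpen (m := ∞) (by simp)).differentiableOn
      (by simp)).differentiableAt (h.isOpen.mem_nhds hq)
  have hθd : ∀ q ∈ U, DifferentiableAt ℝ θ q := fun q hq =>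
    (h.smooth_form.differentiableOn (by simp)).differentiableAt (h.isOpen.mem_nhds hq)
  have hBd : ∀ q ∈ U, DifferentiableAt ℝ (ansatzCoframe p θ) q := fun q hq =>
    ((contDiffOn_ansatzCoframe h).differentiableOn (by simp)).differentiableAt
      (h.isOpen.mem_nhds hq)
  have hdiag : ∀ q ∈ U, ∀ i, 0 < ansatzDiag V f (p q) i := by
    intro q hq i
    have := hz q hq
    have := hv q hq
    fin_cases i <;> simp [ansatzDiag] <;> positivity
  have hD := fun q hq => fderiv_ansatzDiag (hz q hq).ne' (hv q hq).ne' (hVd q hq) (hfd q hq) s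
  refine ⟨h.isOpen, (contDiffOn_ansatzCoframe h).of_le two_le_infty, ?_, ?_, ?_, ?_,
    ?_, ?_, ?_, ?_⟩
  · intro q hq
    rw [ContinuousLinearMap.isUnit_iff_bijective]
    have hinj : Function.Injective (ansatzCoframe p θ q : E 4 →ₗ[ℝ] E 4) := by
      rw [← LinearMap.ker_eq_bot, LinearMap.ker_eq_bot']
      intro u hu
      obtain ⟨h0, h1, h2, h3⟩ := ansatzCoframe_apply p θ q u
      have hu' : ansatzCoframe p θ q u = 0 := hu
      simp only [hu', PiLp.zero_apply] at h0 h1 h2 h3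
      refine h.injective q hq u ?_ h3.symm
      ext i
      fin_cases i
      exacts [h0.symm, h1.symm, h2.symm]
    exact ⟨hinj, LinearMap.injective_iff_surjective.1 hinj⟩
  · intro q hq u v
    obtain ⟨a0, a1, a2, a3⟩ := ansatzCoframe_apply p θ q u
    obtain ⟨b0, b1, b2, b3⟩ := ansatzCoframe_apply p θ q v
    simp only [hG q hq, diagForm_apply, Fin.sum_univ_four, a0, a1, a2, a3, b0, b1, b2, b3,
      ansatzChartMetric, hyp_eq, ansatzDiag, Matrix.cons_val]
    ring
  · intro q hq
    exact diagForm.differentiableAt.comp q ((hD q hq).1.comp q (hpd q hq))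
  · intro q hq b c
    simp only [diagForm_apply, mul_comm]
  · intro q hq b hb
    ext i
    have := hb (basisVec i)
    simpa [diagForm_apply, basisVec, (hdiag q hq i).ne'] using this
  · intro q hq
    exact coeffMap.differentiableAt.comp q (ansatzCoeffL.differentiableAt.comp q
      ((differentiableAt_ansatzJetAt s (hz q hq).ne' (hv q hq).ne' (hVd q hq) (hV'd q hq)
        (hf'd q hq)).comp q (hpd q hq)))
  · intro q hq u b c
    have hd : fderiv ℝ (fun q => diagForm (ansatzDiag V f (p q))) q u
        = diagForm (fderiv ℝ (ansatzDiag V f) (p q) (fderiv ℝ p q u)) := by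
      have := (diagForm.hasFDerivAt.comp q
        ((hD q hq).1.hasFDerivAt.comp q (hpd q hq).hasFDerivAt)).fderiv
      exact DFunLike.congr_fun this u
    obtain ⟨a0, a1, a2, a3⟩ := ansatzCoframe_apply p θ q u
    have := (hz q hq).ne'
    have := (hv q hq).ne'
    rw [hd]
    simp only [diagForm_apply, (hD q hq).2, ansatzConn, coeffMap_apply, Fin.sum_univ_four, a0, a1,
      a2, a3]
    simp only [ansatzCoeffL, LinearMap.coe_toContinuousLinearMap', LinearMap.coe_mk, AddHom.coe_mk,
      ansatzCoeff, ansatzJetAt, ansatzJet, ansatzDiag, Fin.sum_univ_three, Matrix.cons_val,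
      Fin.isValue, Fin.reduceEq, if_true, if_false]
    field_simp
    ring
  · intro q hq u v
    obtain ⟨a0, a1, a2, a3⟩ := ansatzCoframe_apply p θ q u
    obtain ⟨b0, b1, b2, b3⟩ := ansatzCoframe_apply p θ q v
    -- The base forms are differentials of the components of `p`, so only the θ component has a
    -- nonzero exterior derivative.
    have hsymm : fderiv ℝ (fderiv ℝ p) q u v = fderiv ℝ (fderiv ℝ p) q v u :=
      (h.smooth_proj.contDiffAt (h.isOpen.mem_nhds hq)).isSymmSndFDerivAt
      (by simpa using two_le_infty) u v
    rw [fderiv_ansatzCoframe (hBd q hq) (hp'd q hq) (hθd q hq),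
      fderiv_ansatzCoframe (hBd q hq) (hp'd q hq) (hθd q hq), hsymm, add_sub_add_left_eq_sub, ← sub_smul, h.curvature q hq, starOne_hyp hs (hz q hq)]
    ext k
    simp only [PiLp.sub_apply, ansatzConn, coeffMap_apply, Fin.sum_univ_four, a0, a1, a2, a3,
      b0, b1, b2, b3, PiLp.smul_apply, smul_eq_mul]
    simp only [ansatzCoeffL, LinearMap.coe_toContinuousLinearMap', LinearMap.coe_mk, AddHom.coe_mk,
      ansatzCoeff, ansatzJetAt, ansatzJet, pd]
    fin_cases k <;> simp [basisVec] <;> ring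

/-- The right-hand side of the Ricci formula, evaluated on vectors with projections `a`, `b` to the
base on which the connection form takes the values `α`, `β`. -/
def ansatzRicciForm (o : Orientation ℝ (E 3) (Fin 3)) (V f : E 3 → ℝ) (x a b : E 3) (α β : ℝ) : ℝ :=
  let dV : E 3 → ℝ := fderiv ℝ V x
  let df : E 3 → ℝ := fderiv ℝ f x
  let Δf := laplacian hyp f x
  let dfdf := cometric hyp x df df
  let dVdf := cometric hyp x dV df
  (-2 - Δf - 2 * dfdf - (V x)⁻¹ * dVdf) * hyp x a b - 2 * hessian hyp f x a b
    + 2 * symProd df df a b + 2 * (V x)⁻¹ * symProd dV df a b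
    + (-Δf - 2 * dfdf + (V x)⁻¹ * dVdf) * (((V x)⁻¹ * α) * ((V x)⁻¹ * β))
    - (V x)⁻¹ * (starTwo o hyp x (wedge dV df) a * ((V x)⁻¹ * β)
      + starTwo o hyp x (wedge dV df) b * ((V x)⁻¹ * α))

theorem fderiv_ansatzConn {w : E 4} (hJ : DifferentiableAt ℝ (ansatzJetAt s V f) (p q))
    (hp : DifferentiableAt ℝ p q) : fderiv ℝ (ansatzConn s p V f) q w
      = coeffMap (ansatzCoeffL (fderiv ℝ (ansatzJetAt s V f) (p q) (fderiv ℝ p q w))) := by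
  have := (coeffMap.hasFDerivAt.comp q (ansatzCoeffL.hasFDerivAt.comp q
    (hJ.hasFDerivAt.comp q hp.hasFDerivAt))).fderiv
  exact DFunLike.congr_fun this w

/-- Here `a'` and `b'` are coframe components: the base projection followed by the value of θ. The
summation order matches that of `sum_frameCurv_coeffMap`, in which the second tangent vector comes
first. -/
theorem ansatzRicciForm_eq_sum
    (hs : ∀ u v w, o.volumeForm ![u, v, w] = s * (u 0 * (v 1 * w 2 - v 2 * w 1)
      - u 1 * (v 0 * w 2 - v 2 * w 0) + u 2 * (v 0 * w 1 - v 1 * w 0)))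
    {x : E 3} (hx : 0 < x 2) {a b : E 3} {α β : ℝ} {a' b' : E 4}
    (ha : a' 0 = a 0 ∧ a' 1 = a 1 ∧ a' 2 = a 2 ∧ a' 3 = α)
    (hb : b' 0 = b 0 ∧ b' 1 = b 1 ∧ b' 2 = b 2 ∧ b' 3 = β) :
    ansatzRicciForm o V f x a b α β = ∑ i, ∑ j, b' i * a' j *
      ansatzRicci s (x 2) (V x) (fun k => pd k f x) (fun k => pd k V x)
        (hypHess (x 2) (fun k => pd k f x) (fun k l => pd k (pd l f) x)) j i := by
  obtain ⟨a0, a1, a2, a3⟩ := ha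
  obtain ⟨b0, b1, b2, b3⟩ := hb
  simp only [ansatzRicciForm, starTwo_wedge_hyp hs hx, hessian_hyp hx.ne', laplacian_hyp hx.ne',
    cometric_hyp hx.ne', symProd, hyp_eq, Fin.sum_univ_four, Fin.sum_univ_three, a0, a1, a2, a3,
    b0, b1, b2, b3, ansatzRicci, Matrix.cons_val]
  simp only [fderiv_eq_sum_pd f, fderiv_eq_sum_pd V, Fin.sum_univ_three]
  simp only [basisVec]
  simp
  ring

theorem ansatzRicci_symm {z v : ℝ} {f₁ V₁ : Fin 3 → ℝ} {H : Fin 3 → Fin 3 → ℝ}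
    (hH : ∀ i j, H i j = H j i) (i j : Fin 4) :
    ansatzRicci s z v f₁ V₁ H i j = ansatzRicci s z v f₁ V₁ H j i := by
  have h1 := hH 1 0
  have h2 := hH 2 0
  have h3 := hH 2 1
  fin_cases i <;> fin_cases j <;> simp [ansatzRicci, h1, h2, h3] <;> ring

theorem hypHess_symm {z : ℝ} {f₁ : Fin 3 → ℝ} {f₂ : Fin 3 → Fin 3 → ℝ}
    (hf : ∀ i j, f₂ i j = f₂ j i) (i j : Fin 3) : hypHess z f₁ f₂ i j = hypHess z f₁ f₂ j i := by
  simp only [hypHess, hf i j, eq_comm (a := i) (b := j)]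
  congr 2
  by_cases h : j = i
  · simp [h]
  · simp [h, add_comm]

theorem ricciCoord_ansatzChartMetric (h : IsAnsatzChart o 𝒱 V U p θ)
    (hG : ∀ q ∈ U, ∀ u v, G q u v = ansatzChartMetric p θ V f q u v) (h𝒱 : IsOpen 𝒱)
    (h𝒱H : 𝒱 ⊆ upperHalfSpace) (hVpos : ∀ x ∈ 𝒱, 0 < V x) (hV : IsHarmonicOn V 𝒱)
    (hf : ContDiffOn ℝ 2 f 𝒱) (hq : q ∈ U) (u v : E 4) :
    ricciCoord G q u v
      = ansatzRicciForm o V f (p q) (fderiv ℝ p q u) (fderiv ℝ p q v) (θ q u) (θ q v) := by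
  obtain ⟨s, hs1, hs⟩ := exists_volumeForm_eq o
  have hz : 0 < p q 2 := h𝒱H (h.mapsTo q hq)
  have hv : 0 < V (p q) := hVpos _ (h.mapsTo q hq)
  have hnhds := h𝒱.mem_nhds (h.mapsTo q hq)
  have hVd := (hV.1.differentiableOn (by norm_num)).differentiableAt hnhds
  have hV'd := fun k =>
    ((contDiffOn_pd h𝒱 hV.1 k).differentiableOn (by norm_num)).differentiableAt hnhds
  have hf'd := fun k =>
    ((contDiffOn_pd h𝒱 hf k).differentiableOn (by norm_num)).differentiableAt hnhds
  have hpd : DifferentiableAt ℝ p q :=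
    (h.smooth_proj.differentiableOn (by simp)).differentiableAt (h.isOpen.mem_nhds hq)
  have hLC := isLeviCivitaFrame_ansatz h hG h𝒱 h𝒱H hVpos hV.1 hf hs
  -- The coefficients are pulled back from the base. The first three frame vectors project to the
  -- coordinate vectors, and the fourth is vertical, so the derivative along it vanishes.
  have hdC : ∀ i, fderiv ℝ (ansatzConn s p V f) q
      (Ring.inverse (ansatzCoframe p θ q) (basisVec i))
      = coeffMap (ansatzFrameDeriv s (p q 2) (V (p q)) (fun k => pd k f (p q))
        (fun k => pd k V (p q)) (fun k l => pd k (pd l f) (p q))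
        (fun k l => pd k (pd l V) (p q)) i) := by
    intro i
    set w := Ring.inverse (ansatzCoframe p θ q) (basisVec i) with hw
    have hBw : ansatzCoframe p θ q w = basisVec i := hLC.coframe_inverse hq _
    obtain ⟨h0, h1, h2, -⟩ := ansatzCoframe_apply p θ q w
    rw [hBw] at h0 h1 h2
    have hpw : ∀ k : Fin 3, i = k.castSucc → fderiv ℝ p q w = basisVec k := by
      rintro k rfl
      ext l
      fin_cases k <;> fin_cases l <;> simp [← h0, ← h1, ← h2, basisVec]
    have hJ := differentiableAt_ansatzJetAt s hz.ne' hv.ne' hVd hV'd hf'd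
    rw [fderiv_ansatzConn hJ hpd]
    congr 1
    have hbase : ∀ k : Fin 3, fderiv ℝ (ansatzJetAt s V f) (p q) (basisVec k)
        = ansatzJetDeriv s (p q 2) (V (p q)) (if k = 2 then 1 else 0) (pd k V (p q))
          (fun l => pd l f (p q)) (fun l => pd l V (p q)) (fun l => pd k (pd l f) (p q))
          (fun l => pd k (pd l V) (p q)) := by
      intro k
      rw [fderiv_ansatzJetAt s hz.ne' hv.ne' hVd hV'd hf'd]
      simp only [pd]
      congr 1
      simp [basisVec, eq_comm]
    fin_cases i
    · rw [hpw 0 rfl, hbase]; rfl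
    · rw [hpw 1 rfl, hbase]; rfl
    · rw [hpw 2 rfl, hbase]; rfl
    · have : fderiv ℝ p q w = 0 := by
        ext l
        fin_cases l <;> simp [← h0, ← h1, ← h2, basisVec]
      rw [this, map_zero, map_zero]
      rfl
  have hfs := fun k l => pd_comm h𝒱 hf (h.mapsTo q hq) k l
  have hVs := fun k l => pd_comm h𝒱 hV.1 (h.mapsTo q hq) k l
  -- In these coordinates the Laplacian of V is z²(V_xx + V_yy + V_zz) - z V_z, and z is nonzero.
  have hharm : pd 2 (pd 2 V) (p q)
      = pd 2 V (p q) / p q 2 - pd 0 (pd 0 V) (p q) - pd 1 (pd 1 V) (p q) := by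
    have := hV.2 _ (h.mapsTo q hq)
    rw [laplacian_hyp hz.ne', mul_eq_zero] at this
    have := this.resolve_left (pow_ne_zero 2 hz.ne')
    simp [Fin.sum_univ_three, hypHess] at this
    linear_combination this
  rw [hLC.ricciCoord_eq hq, sum_frameCurv_coeffMap rfl hdC,
    ansatzRicciForm_eq_sum hs hz (ansatzCoframe_apply p θ q u) (ansatzCoframe_apply p θ q v)]
  refine Finset.sum_congr rfl fun i _ => Finset.sum_congr rfl fun j _ => ?_
  -- The two sums carry transposed indices; the claimed tensor is symmetric because the Hessian of f
  -- is.
  rw [ansatzRicci_symm (hypHess_symm hfs), ← ricciContraction_ansatz s _ _ _ _ _ _ hs1 hz.ne'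
    hv.ne' hfs hVs hharm]
  rfl

end

/-! ### Charts -/

section Chart

variable {n : ℕ} {M : Type*} [TopologicalSpace M] [ChartedSpace (E n) M]

/-- The derivative of the chart at `m`, as a map between coordinate spaces. -/
def chartDeriv (m x : M) : E n →L[ℝ] E n := mfderiv (𝓡 n) (𝓡 n) (extChartAt (𝓡 n) m) x

/-- The derivative of the inverse of the chart at `m`, as a map between coordinate spaces. -/
def chartSymmDeriv (m : M) (y : E n) : E n →L[ℝ] E n :=
  mfderiv (𝓡 n) (𝓡 n) (extChartAt (𝓡 n) m).symm y

/-- The change of coordinates from the chart at `m` to the chart at `m'`. -/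
def coordChange (m m' : M) : E n → E n := extChartAt (𝓡 n) m' ∘ (extChartAt (𝓡 n) m).symm

variable [IsManifold (𝓡 n) ∞ M]

theorem mdifferentiableAt_chart_symm {m : M} {y : E n} (hy : y ∈ (extChartAt (𝓡 n) m).target) :
    MDifferentiableAt (𝓡 n) (𝓡 n) (extChartAt (𝓡 n) m).symm y :=
  ((contMDiffOn_extChartAt_symm (n := ∞) m).contMDiffAt
    ((isOpen_extChartAt_target m).mem_nhds hy)).mdifferentiableAt (by simp)

theorem mdifferentiableAt_chart {m x : M} (hx : x ∈ (extChartAt (𝓡 n) m).source) :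
    MDifferentiableAt (𝓡 n) (𝓡 n) (extChartAt (𝓡 n) m) x :=
  (contMDiffAt_extChartAt' (n := ∞) (by simpa using hx)).mdifferentiableAt (by simp)

theorem contDiffAt_coordChange {m m' : M} {y : E n} (hy : y ∈ (extChartAt (𝓡 n) m).target)
    (hy' : (extChartAt (𝓡 n) m).symm y ∈ (extChartAt (𝓡 n) m').source) :
    ContDiffAt ℝ ∞ (coordChange m m') y :=
  contMDiffAt_iff_contDiffAt.1 <| ContMDiffAt.comp (I' := 𝓡 n) y
    (contMDiffAt_extChartAt' (n := ∞) (by simpa using hy'))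
    ((contMDiffOn_extChartAt_symm (n := ∞) m).contMDiffAt
      ((isOpen_extChartAt_target m).mem_nhds hy))

theorem fderiv_coordChange {m m' : M} {y : E n} (hy : y ∈ (extChartAt (𝓡 n) m).target)
    (hy' : (extChartAt (𝓡 n) m).symm y ∈ (extChartAt (𝓡 n) m').source) :
    fderiv ℝ (coordChange m m') y
      = (chartDeriv m' ((extChartAt (𝓡 n) m).symm y)).comp (chartSymmDeriv m y) := by
  rw [← mfderiv_eq_fderiv]
  exact mfderiv_comp (I' := 𝓡 n) y (mdifferentiableAt_chart hy') (mdifferentiableAt_chart_symm hy)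

/-- Differentiating the factorization of one inverse chart through another lets a form in one chart
be written as the pull-back of its expression in the other. -/
theorem chartSymmDeriv_coordChange {m m' : M} {y : E n} (hy : y ∈ (extChartAt (𝓡 n) m).target)
    (hy' : (extChartAt (𝓡 n) m).symm y ∈ (extChartAt (𝓡 n) m').source) :
    chartSymmDeriv m y
      = (chartSymmDeriv m' (coordChange m m' y)).comp (fderiv ℝ (coordChange m m') y) := by
  have hcont : ContinuousAt (extChartAt (𝓡 n) m).symm y :=
    (mdifferentiableAt_chart_symm hy).continuousAt
  have e : (extChartAt (𝓡 n) m).symm =ᶠ[nhds y]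
      (extChartAt (𝓡 n) m').symm ∘ coordChange m m' := by
    filter_upwards [hcont.preimage_mem_nhds ((isOpen_extChartAt_source m').mem_nhds hy')]
      with z hz using ((extChartAt (𝓡 n) m').left_inv hz).symm
  have hd := (contDiffAt_coordChange hy hy').differentiableAt (by simp)
  rw [← mfderiv_eq_fderiv]
  exact e.mfderiv_eq.trans (mfderiv_comp (I' := 𝓡 n) y
    (mdifferentiableAt_chart_symm ((extChartAt (𝓡 n) m').map_source hy'))
    hd.mdifferentiableAt)

theorem chartSymmDeriv_chartDeriv {m x : M} (hx : x ∈ (extChartAt (𝓡 n) m).source) (u : E n) :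
    chartSymmDeriv m (extChartAt (𝓡 n) m x) (chartDeriv m x u) = u := by
  have e : (extChartAt (𝓡 n) m).symm ∘ extChartAt (𝓡 n) m =ᶠ[nhds x] id := by
    filter_upwards [(isOpen_extChartAt_source m).mem_nhds hx] with z hz
      using (extChartAt (𝓡 n) m).left_inv hz
  have h1 := mfderiv_comp (I' := 𝓡 n) x
    (mdifferentiableAt_chart_symm ((extChartAt (𝓡 n) m).map_source hx))
    (mdifferentiableAt_chart hx)
  have h2 := e.mfderiv_eq.symm.trans h1
  rw [mfderiv_id] at h2
  exact (DFunLike.congr_fun h2 u).symm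

theorem chartDeriv_chartSymmDeriv {m : M} {y : E n} (hy : y ∈ (extChartAt (𝓡 n) m).target)
    (u : E n) : chartDeriv m ((extChartAt (𝓡 n) m).symm y) (chartSymmDeriv m y u) = u := by
  have e : extChartAt (𝓡 n) m ∘ (extChartAt (𝓡 n) m).symm =ᶠ[nhds y] id := by
    filter_upwards [(isOpen_extChartAt_target m).mem_nhds hy] with z hz
      using (extChartAt (𝓡 n) m).right_inv hz
  have h1 := mfderiv_comp (I' := 𝓡 n) y
    (mdifferentiableAt_chart ((extChartAt (𝓡 n) m).map_target hy))
    (mdifferentiableAt_chart_symm hy)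
  have h2 := e.mfderiv_eq.symm.trans h1
  rw [mfderiv_id] at h2
  exact (DFunLike.congr_fun h2 u).symm

/-- The exterior derivative of a `1`-form may be computed in any chart. -/
theorem fderiv_coordForm₁_sub {θ : (x : M) → TangentSpace (𝓡 n) x →L[ℝ] ℝ}
    (hθ : IsSmoothOneForm θ) {m : M} {y : E n} (hy : y ∈ (extChartAt (𝓡 n) m).target) (u v : E n) :
    fderiv ℝ (coordForm₁ θ m) y u v - fderiv ℝ (coordForm₁ θ m) y v u
      = extDerivOne θ ((extChartAt (𝓡 n) m).symm y) (chartSymmDeriv m y u)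
        (chartSymmDeriv m y v) := by
  set m' := (extChartAt (𝓡 n) m).symm y with hm'
  have hy' : m' ∈ (extChartAt (𝓡 n) m').source := mem_extChartAt_source m'
  have hcont : ContinuousAt (extChartAt (𝓡 n) m).symm y :=
    (mdifferentiableAt_chart_symm hy).continuousAt
  set τ : E n → E n := coordChange m m'
  -- Near `y`, the expression in the chart at `m` is the pull-back by the transition map `τ` of the
  -- expression in the chart at `m'`.
  have e : coordForm₁ θ m =ᶠ[nhds y]
      fun z => (coordForm₁ θ m' (τ z)).comp (fderiv ℝ τ z) := by
    filter_upwards [hcont.preimage_mem_nhds ((isOpen_extChartAt_source m').mem_nhds hy'),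
      (isOpen_extChartAt_target m).mem_nhds hy] with z hz hz'
    have h1 := chartSymmDeriv_coordChange hz' hz
    have h2 : (extChartAt (𝓡 n) m').symm (τ z) = (extChartAt (𝓡 n) m).symm z :=
      (extChartAt (𝓡 n) m').left_inv hz
    let Θ : M → E n →L[ℝ] ℝ := θ
    change (Θ _).comp (chartSymmDeriv m z)
      = ((Θ ((extChartAt (𝓡 n) m').symm (τ z))).comp (chartSymmDeriv m' (τ z))).comp _
    rw [h2, h1, ContinuousLinearMap.comp_assoc]
  have hτ : ContDiffAt ℝ ∞ τ y := contDiffAt_coordChange hy hy'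
  have hτ' : DifferentiableAt ℝ (fderiv ℝ τ) y :=
    (hτ.fderiv_right (m := 1) (by rw [one_add_one_eq_two]; exact two_le_infty)).differentiableAt (by simp)
  have hf : DifferentiableAt ℝ (coordForm₁ θ m') (τ y) :=
    ((hθ m').differentiableOn (by simp)).differentiableAt
      ((isOpen_extChartAt_target m').mem_nhds ((extChartAt (𝓡 n) m').map_source hy'))
  have hfd := ((hf.hasFDerivAt.comp y (hτ.differentiableAt (by simp)).hasFDerivAt).clm_comp
    hτ'.hasFDerivAt).fderiv
  -- The second derivative of the transition map is the only non-tensorial term, and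
  -- antisymmetrization kills it.
  have hsymm : fderiv ℝ (fderiv ℝ τ) y u v = fderiv ℝ (fderiv ℝ τ) y v u :=
    hτ.isSymmSndFDerivAt (by simpa using two_le_infty) u v
  have hτy : ∀ w, fderiv ℝ τ y w = chartDeriv m' m' (chartSymmDeriv m y w) := fun w =>
    DFunLike.congr_fun (fderiv_coordChange hy hy') w
  have hval : ∀ a b, fderiv ℝ (coordForm₁ θ m) y a b
      = fderiv ℝ (coordForm₁ θ m') (τ y) (fderiv ℝ τ y a) (fderiv ℝ τ y b)
        + coordForm₁ θ m' (τ y) (fderiv ℝ (fderiv ℝ τ) y a b) := by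
    intro a b
    have := DFunLike.congr_fun (DFunLike.congr_fun (e.fderiv_eq.trans hfd) a) b
    simpa [add_comm] using this
  rw [hval, hval, hsymm, add_sub_add_right_eq_sub, hτy, hτy]
  rfl

end Chart

/-! ### The ansatz in the charts of a circle bundle -/

section Bundle

variable {o : Orientation ℝ (E 3) (Fin 3)} {𝒱 : Set (E 3)} {V : E 3 → ℝ}
  {M : Type*} [TopologicalSpace M] [ChartedSpace (E 4) M] [MulAction Circle M]
  {π : M → E 3} {θ : (x : M) → TangentSpace (𝓡 4) x →L[ℝ] ℝ}

/-- A local trivialization supplies a smooth local section through `m`, whose differential is a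
right inverse of the differential of `π`. -/
theorem IsCircleBundle.dproj_surjective (hπ : IsCircleBundle π 𝒱) (m : M) :
    Function.Surjective (dproj π m) := by
  obtain ⟨U, hU, hmU, -, Φ, hsrc, htgt, -, hΦs, hfst, -⟩ :=
    hπ.locally_trivial (π m) (hπ.proj_mem m)
  have hm : m ∈ Φ.source := by rw [hsrc]; exact hmU
  let ι : E 3 → E 3 × Circle := fun x => (x, (Φ m).2)
  let σ : E 3 → M := Φ.symm ∘ ι
  have hσm : σ (π m) = m := by
    change Φ.symm (π m, (Φ m).2) = m
    rw [← hfst m hm]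
    exact Φ.left_inv hm
  have hι : ContMDiff (𝓡 3) ((𝓡 3).prod (𝓡 1)) ∞ ι := contMDiff_id.prodMk contMDiff_const
  have hσ : MDifferentiableAt (𝓡 3) (𝓡 4) σ (π m) := by
    have h1 : ContMDiffAt ((𝓡 3).prod (𝓡 1)) (𝓡 4) ∞ Φ.symm (ι (π m)) :=
      hΦs.contMDiffAt (by
        rw [htgt]
        exact (hU.prod isOpen_univ).mem_nhds ⟨hmU, trivial⟩)
    exact (h1.comp (π m) (hι _)).mdifferentiableAt (by simp)
  have hπm : MDifferentiableAt (𝓡 4) (𝓡 3) π (σ (π m)) :=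
    (hπ.smooth_proj _).mdifferentiableAt (by simp)
  have e : π ∘ σ =ᶠ[nhds (π m)] id := by
    filter_upwards [hU.mem_nhds hmU] with x hx
    have hx' : ι x ∈ Φ.target := by rw [htgt]; exact ⟨hx, trivial⟩
    have h1 := hfst _ (Φ.map_target hx')
    rw [Φ.right_inv hx'] at h1
    exact h1.symm
  have h2 := e.mfderiv_eq.symm.trans (mfderiv_comp (I' := 𝓡 4) (π m) hπm hσ)
  rw [mfderiv_id] at h2
  let dπ : M → E 4 →L[ℝ] E 3 := fun x => mfderiv (𝓡 4) (𝓡 3) π x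
  have h3 : ∀ w : E 3, w = dπ (σ (π m)) (mfderiv (𝓡 3) (𝓡 4) σ (π m) w) :=
    fun w => DFunLike.congr_fun h2 w
  rw [hσm] at h3
  exact fun w => ⟨_, (h3 w).symm⟩

theorem IsCircleBundle.dproj_generator (hπ : IsCircleBundle π 𝒱) (m : M) :
    dproj π m (generatorAt m) = 0 := by
  let γ : ℝ → M := fun t => Circle.exp t • m
  have hγ0 : γ 0 = m := by simp [γ]
  let dπ : M → E 4 →L[ℝ] E 3 := fun x => mfderiv (𝓡 4) (𝓡 3) π x
  change dπ m (mfderiv 𝓘(ℝ, ℝ) (𝓡 4) γ 0 (1 : ℝ)) = 0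
  by_cases hγ : MDifferentiableAt 𝓘(ℝ, ℝ) (𝓡 4) γ 0
  · have hπm : MDifferentiableAt (𝓡 4) (𝓡 3) π (γ 0) :=
      (hπ.smooth_proj _).mdifferentiableAt (by simp)
    have h1 := mfderiv_comp (I' := 𝓡 4) (0 : ℝ) hπm hγ
    have h2 : π ∘ γ = fun _ => π m := funext fun t => hπ.proj_smul _ _
    rw [h2, mfderiv_const] at h1
    have h3 : (0 : E 3) = dπ (γ 0) (mfderiv 𝓘(ℝ, ℝ) (𝓡 4) γ 0 (1 : ℝ)) :=
      DFunLike.congr_fun h1 (1 : ℝ)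
    rw [hγ0] at h3
    exact h3.symm
  -- If the orbit curve were not differentiable, `generatorAt m` would be the default value 0, and
  -- the claim would still hold.
  · rw [mfderiv_zero_of_not_mdifferentiableAt hγ]
    exact map_zero _

/-- By surjectivity the kernel of the differential of `π` has dimension 4 - 3 = 1. It contains the
generator ξ, nonzero because θ(ξ) = 1. A vertical vector is thus cξ, and θ reads off c. -/
theorem IsCircleBundle.eq_zero_of_dproj_eq_zero (hπ : IsCircleBundle π 𝒱)
    (hθ : IsConnectionForm θ) (m : M) {u : TangentSpace (𝓡 4) m} (hu : dproj π m u = 0)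
    (hu' : θ m u = 0) : u = 0 := by
  let dπ : E 4 →L[ℝ] E 3 := mfderiv (𝓡 4) (𝓡 3) π m
  let L : E 4 →ₗ[ℝ] E 3 := dπ
  let ϑ : E 4 →L[ℝ] ℝ := θ m
  let ξ : E 4 := generator m
  have hξ : ϑ ξ = 1 := hθ.normalized m
  have hker : Module.finrank ℝ (LinearMap.ker L) = 1 := by
    have h1 := L.finrank_range_add_finrank_ker
    have hL : Function.Surjective L := hπ.dproj_surjective m
    rw [LinearMap.range_eq_top.2 hL] at h1
    simp at h1
    omega
  have hξ0 : (⟨ξ, hπ.dproj_generator m⟩ : LinearMap.ker L) ≠ 0 := by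
    intro h
    have : ξ = 0 := congrArg Subtype.val h
    rw [this, map_zero] at hξ
    exact zero_ne_one hξ
  obtain ⟨c, hc⟩ := exists_smul_eq_of_finrank_eq_one hker hξ0 ⟨u, hu⟩
  have hc' : c • ξ = u := congrArg Subtype.val hc
  have : ϑ u = 0 := hu'
  rw [← hc', map_smul, hξ, smul_eq_mul, mul_one] at this
  rw [← hc', this, zero_smul]
  rfl

variable [IsManifold (𝓡 4) ∞ M]

theorem IsCircleBundle.fderiv_proj_chart (hπ : IsCircleBundle π 𝒱) {m : M} {y : E 4}
    (hy : y ∈ (extChartAt (𝓡 4) m).target) (u : E 4) :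
    fderiv ℝ (π ∘ (extChartAt (𝓡 4) m).symm) y u
      = dproj π ((extChartAt (𝓡 4) m).symm y) (chartSymmDeriv m y u) := by
  have hπm : MDifferentiableAt (𝓡 4) (𝓡 3) π ((extChartAt (𝓡 4) m).symm y) :=
    (hπ.smooth_proj _).mdifferentiableAt (by simp)
  rw [← mfderiv_eq_fderiv]
  exact DFunLike.congr_fun
    (mfderiv_comp (I' := 𝓡 4) y hπm (mdifferentiableAt_chart_symm hy)) u

/-- The curvature hypothesis is expressed at each point in the chart at that point. Chart
independence of the exterior derivative transfers it to the whole target of one chart, which is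
needed because the Ricci tensor differentiates the connection. -/
theorem IsCircleBundle.isAnsatzChart (hπ : IsCircleBundle π 𝒱) (hθ : IsConnectionForm θ)
    (hcurv : HasCurvatureStarD o π θ V) (m : M) :
    IsAnsatzChart o 𝒱 V (extChartAt (𝓡 4) m).target (π ∘ (extChartAt (𝓡 4) m).symm)
      (coordForm₁ θ m) where
  isOpen := isOpen_extChartAt_target m
  mapsTo _ _ := hπ.proj_mem _
  smooth_proj := contMDiffOn_iff_contDiffOn.1
    (hπ.smooth_proj.comp_contMDiffOn (contMDiffOn_extChartAt_symm m))
  smooth_form := hθ.smooth m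
  injective y hy u hu hu' := by
    rw [hπ.fderiv_proj_chart hy] at hu
    have h0 : chartSymmDeriv m y u = 0 := hπ.eq_zero_of_dproj_eq_zero hθ _ hu hu'
    rw [← chartDeriv_chartSymmDeriv hy u, h0, map_zero]
  curvature y hy u v := by
    rw [hπ.fderiv_proj_chart hy, hπ.fderiv_proj_chart hy]
    exact (fderiv_coordForm₁_sub hθ.smooth hy u v).trans (hcurv _ _ _)

/-- The chart computation is evaluated at the image of `m` on vectors pushed forward by the chart;
the chart and its inverse then cancel in the differential of `π` and in θ. -/
theorem IsCircleBundle.ricci_conformalAnsatz (hπ : IsCircleBundle π 𝒱) (hθ : IsConnectionForm θ)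
    (hcurv : HasCurvatureStarD o π θ V) (h𝒱 : IsOpen 𝒱) (h𝒱H : 𝒱 ⊆ upperHalfSpace)
    (hVpos : ∀ x ∈ 𝒱, 0 < V x) (hV : IsHarmonicOn V 𝒱) {f : E 3 → ℝ} (hf : ContDiffOn ℝ 2 f 𝒱)
    (m : M) (u v : TangentSpace (𝓡 4) m) :
    ricci (conformalAnsatz π θ V f) m u v
      = ansatzRicciForm o V f (π m) (dproj π m u) (dproj π m v) (θ m u) (θ m v) := by
  have hy := mem_extChartAt_target (I := 𝓡 4) m
  have hG : ∀ y ∈ (extChartAt (𝓡 4) m).target, ∀ a b,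
      coordForm₂ (conformalAnsatz π θ V f) m y a b = ansatzChartMetric
        (π ∘ (extChartAt (𝓡 4) m).symm) (coordForm₁ θ m) V f y a b := by
    intro y hy a b
    rw [ansatzChartMetric, hπ.fderiv_proj_chart hy, hπ.fderiv_proj_chart hy]
    rfl
  let dπ : M → E 4 →L[ℝ] E 3 := fun x => mfderiv (𝓡 4) (𝓡 3) π x
  let Θ : M → E 4 →L[ℝ] ℝ := θ
  have hm : (extChartAt (𝓡 4) m).symm (extChartAt (𝓡 4) m m) = m := extChartAt_to_inv m
  have hD : ∀ w : E 4, chartSymmDeriv m (extChartAt (𝓡 4) m m) (chartDeriv m m w) = w := fun w =>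
    chartSymmDeriv_chartDeriv (mem_extChartAt_source m) w
  have hproj : ∀ w : E 4, fderiv ℝ (π ∘ (extChartAt (𝓡 4) m).symm) (extChartAt (𝓡 4) m m)
      (chartDeriv m m w) = dπ m w := by
    intro w
    have h1 : _ = dπ _ _ := hπ.fderiv_proj_chart hy (chartDeriv m m w)
    rw [h1, hD, hm]
  have hform : ∀ w : E 4, coordForm₁ θ m (extChartAt (𝓡 4) m m) (chartDeriv m m w) = Θ m w := by
    intro w
    change Θ ((extChartAt (𝓡 4) m).symm (extChartAt (𝓡 4) m m))
      (chartSymmDeriv m (extChartAt (𝓡 4) m m) (chartDeriv m m w)) = Θ m w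
    rw [hD, hm]
  have key := fun a b : E 4 => ricciCoord_ansatzChartMetric (hπ.isAnsatzChart hθ hcurv m) hG h𝒱 h𝒱H
    hVpos hV hf hy (chartDeriv m m a) (chartDeriv m m b)
  simp only [hproj, hform, Function.comp_apply, hm] at key
  exact key u v

end Bundle

end HypAnsatz

end

theorem mainTheorem7
    (o : Orientation ℝ (HypAnsatz.E 3) (Fin 3))
    (𝒱 : Set (HypAnsatz.E 3)) (h𝒱 : IsOpen 𝒱) (h𝒱H : 𝒱 ⊆ HypAnsatz.upperHalfSpace)
    (V : HypAnsatz.E 3 → ℝ) (hVpos : ∀ p ∈ 𝒱, 0 < V p) (hV : HypAnsatz.IsHarmonicOn V 𝒱)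
    {M : Type*} [TopologicalSpace M] [ChartedSpace (HypAnsatz.E 4) M] [IsManifold (𝓡 4) ∞ M]
    [MulAction Circle M]
    (π : M → HypAnsatz.E 3) (hπ : HypAnsatz.IsCircleBundle π 𝒱)
    (θ : (x : M) → TangentSpace (𝓡 4) x →L[ℝ] ℝ) (hθ : HypAnsatz.IsConnectionForm θ)
    (hcurv : HypAnsatz.HasCurvatureStarD o π θ V) :
    (∀ f : HypAnsatz.E 3 → ℝ, ContDiffOn ℝ ∞ f 𝒱 →
      ∀ (m : M) (u v : TangentSpace (𝓡 4) m),
        HypAnsatz.ricci (HypAnsatz.conformalAnsatz π θ V f) m u v =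
          let p := π m
          let u' := HypAnsatz.dproj π m u
          let v' := HypAnsatz.dproj π m v
          let dV : HypAnsatz.E 3 → ℝ := fderiv ℝ V p
          let df : HypAnsatz.E 3 → ℝ := fderiv ℝ f p
          let Δf := HypAnsatz.laplacian HypAnsatz.hyp f p
          let dfdf := HypAnsatz.cometric HypAnsatz.hyp p df df
          let dVdf := HypAnsatz.cometric HypAnsatz.hyp p dV df
          (-2 - Δf - 2 * dfdf - (V p)⁻¹ * dVdf) * HypAnsatz.hyp p u' v'
            - 2 * HypAnsatz.hessian HypAnsatz.hyp f p u' v'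
            + 2 * HypAnsatz.symProd df df u' v'
            + 2 * (V p)⁻¹ * HypAnsatz.symProd dV df u' v'
            + (-Δf - 2 * dfdf + (V p)⁻¹ * dVdf)
                * HypAnsatz.symProd (fun w => (V p)⁻¹ * θ m w) (fun w => (V p)⁻¹ * θ m w) u v
            - 2 * (V p)⁻¹ * HypAnsatz.symProd
                (fun w => HypAnsatz.starTwo o HypAnsatz.hyp p (HypAnsatz.wedge dV df)
                  (HypAnsatz.dproj π m w))
                (fun w => (V p)⁻¹ * θ m w) u v) ∧
    (∀ (m : M) (u v : TangentSpace (𝓡 4) m),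
      HypAnsatz.ricci (HypAnsatz.ansatz π θ V) m u v =
        -2 * HypAnsatz.hyp (π m) (HypAnsatz.dproj π m u) (HypAnsatz.dproj π m v)) := by
  have hform : ∀ f : HypAnsatz.E 3 → ℝ, ContDiffOn ℝ ∞ f 𝒱 →
      ∀ (m : M) (u v : TangentSpace (𝓡 4) m), _ := fun f hf =>
    hπ.ricci_conformalAnsatz hθ hcurv h𝒱 h𝒱H hVpos hV (hf.of_le HypAnsatz.two_le_infty)
  refine ⟨fun f hf m u v => ?_, fun m u v => ?_⟩
  · rw [hform f hf]
    simp only [HypAnsatz.ansatzRicciForm, HypAnsatz.symProd]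
    ring
  -- For f = 0 the conformal factor is 1 and every term but -2h contains a derivative of f.
  · have h0 := hform (fun _ => 0) contDiffOn_const m u v
    have hz : HypAnsatz.conformalAnsatz π θ V (fun _ => 0) = HypAnsatz.ansatz π θ V := by
      funext m u v
      simp [HypAnsatz.conformalAnsatz]
    have hpd : ∀ k : Fin 3, HypAnsatz.pd k (fun _ => (0 : ℝ)) = fun _ => 0 := by
      intro k
      funext x
      simp [HypAnsatz.pd]
    rw [hz] at h0
    rw [h0]
    simp [HypAnsatz.ansatzRicciForm, HypAnsatz.laplacian, HypAnsatz.hessian, HypAnsatz.cometric,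
      HypAnsatz.symProd, HypAnsatz.starTwo, HypAnsatz.wedge, hpd]
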